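/- **Conventions.** An sc-Banach space $E$ is a nested sequence $E=E_0\supset E_1\supset E_2\supset\cdots$ of Banach spaces with compact inclusions such that $E_\infty=\bigcap_m E_m$ is dense in each $E_m$. Write $A_m=A\cap E_m$ (with the topology of $E_m$) for $A\subset E$; $E^1$ is the scale with levels $(E^1)_m=E_{m+1}$, and $TE=E^1\oplus E$. A partial quadrant $C\subset E$ is the preimage of $[0,\infty)^n\oplus W$ under an sc-isomorphism $E\cong\mathbb R^n\oplus W$, and $TC=C^1\oplus E$. Let $U\subset C$ be relatively open and $TU=U^1\oplus E$. A map $f\colon U\to V$ is $\mathrm{sc}^0$ if it preserves levels and all restrictions $U_m\to V_m$ are continuous. It is $\mathrm{sc}^1$ if moreover at every $x\in U_1$ the map $f\colon U_1\to F_0$ is Fréchet differentiable, its derivative extends to a bounded operator $Df(x)\colon E_0\to F_0$, and $Tf(x,\xi)=(f(x),Df(x)\xi)$ is $\mathrm{sc}^0$ from $TU$ to $TV$. It is $\mathrm{sc}^{k+1}$ if it is $\mathrm{sc}^1$ and $Tf$ is $\mathrm{sc}^k$, and sc-smooth if it is $\mathrm{sc}^k$ for all $k$. An sc-retract $(O,C,E)$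 is the image $O=r(U)$ of an sc-smooth $r=r\circ r\colon U\to U$ with $U\subset C$ relatively open. A map $f$ on $O$ is an sc-smooth retract map if $f\circ r$ is sc-smooth; then $Df(x)\xi:=D(f\circ r)(x)\xi$ for $(x,\xi)\in TO:=Tr(TU)=\operatorname{Fix}Tr$ (these notions do not depend on $r$). Let $X$ be a topological space. An M-polyfold chart of $X$ is a homeomorphism $\phi\colon V\to O$ from an open set $V\subset X$ onto an sc-retract $(O,C,E)$. Two charts $\phi,\phi'$ are compatible if $\phi'\circ\phi^{-1}$ on $\phi(V\cap V')$ and its inverse are sc-smooth retract maps. An atlas is a set of pairwise compatible charts whose domains cover $X$; two atlases are equivalent if their union is an atlas. An M-polyfold is a paracompact Hausdorff space with an equivalence class of atlases. A map between M-polyfolds is sc-smooth if it is continuous and all its representatives $\psi\circ f\circ\phi^{-1}$ in charts belonging to the equivalence classes are sc-smooth retract maps. Let $X$ be an M-polyfold and $\mathcal A$ an atlas of $X$. Let $X_1$ be the set of points that some chart of $\mathcal A$ maps to level $1$; $X^1$ is this set with the charts $\phi\colon V\cap X_1\to O^1\subset C^1\subset E^1$, $\phi\in\mathcal A$, and the topology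 generated by the preimages of open sets under these charts. Consider tuples $(x,\phi,\xi)$ of a point $x\in X_1$, a chart $\phi\in\mathcal A$ about $x$, and a vector $\xi$ with $(\phi(x),\xi)\in TO$. Put $(x,\phi,\xi)\sim(x',\phi',\xi')$ if $x=x'$ and $D(\phi'\circ\phi^{-1})(\phi(x))\,\xi=\xi'$. Let $TX$ be the set of classes $[x,\phi,\xi]$, let $p\colon TX\to X^1$ be $[x,\phi,\xi]\mapsto x$, and for $\phi\in\mathcal A$ put $TV=p^{-1}(V\cap X_1)$ and $T\phi\colon TV\to TO$, $[x,\phi,\xi]\mapsto(\phi(x),\xi)$. **Theorem.** (1) The relation $\sim$ is an equivalence relation, and the maps $T\phi\colon TV\to TO$ are well-defined bijections. (2) The sets $(T\phi)^{-1}(W)$, with $\phi\in\mathcal A$ and $W\subset TO$ open, form a basis of a topology on $TX$. This topology is Hausdorff and paracompact, and $T\mathcal A=\{(TV,T\phi,(TO,TC,TE))\mid(V,\phi,(O,C,E))\in\mathcal A\}$ is an M-polyfold atlas for it. Thus $TX$ is an M-polyfold. So is $X^1$ with its induced topology and atlas. (3) The projection $p\colon TX\to X^1$ is an sc-smooth map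 between M-polyfolds. (4) These structures depend only on the equivalence class of $\mathcal A$: if $\mathcal A'$ is an equivalent atlas, there are sc-smooth diffeomorphisms $e\colon TX_{\mathcal A}\to TX_{\mathcal A'}$ and $e_1\colon X^1_{\mathcal A}\to X^1_{\mathcal A'}$ such that $e[x,\phi,\xi]=[x',\phi',\xi']$ if and only if $x=x'$ and $D(\phi'\circ\phi^{-1})(\phi(x))\,\xi=\xi'$, such that $e_1(x)=x$, and such that $p\circ e=e_1\circ p$. -/

import Mathlib

open Set Topology

universe u v w

namespace ScCalculus

/-- An sc-Banach space (Banach scale) `E₀ ⊃ E₁ ⊃ E₂ ⊃ …`. The levels are Banach spaces `lvl m`;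
the inclusions of the nested sequence are the injective compact linear operators `incl m`.
A smooth point (an element of the intersection of all levels) is a coherent sequence of points in
the levels, and the smooth points are dense in every level. -/
structure ScBanach where
  lvl : ℕ → Type u
  [normed : ∀ m, NormedAddCommGroup (lvl m)]
  [space : ∀ m, NormedSpace ℝ (lvl m)]
  [complete : ∀ m, CompleteSpace (lvl m)]
  incl : ∀ m, lvl (m + 1) →L[ℝ] lvl m
  incl_injective : ∀ m, Function.Injective (incl m)
  incl_compact : ∀ m, IsCompactOperator (incl m)
  dense_smooth : ∀ m, Dense {x : lvl m |
    ∃ s : ∀ k, lvl k, (∀ k, incl k (s (k + 1)) = s k) ∧ s m = x}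

attribute [instance] ScBanach.normed ScBanach.space ScBanach.complete

namespace ScBanach

/-- The inclusion `E_m → E_0`. -/
def toBase (E : ScBanach.{u}) : ∀ m, E.lvl m →L[ℝ] E.lvl 0
  | 0 => ContinuousLinearMap.id ℝ (E.lvl 0)
  | m + 1 => (toBase E m).comp (E.incl m)

/-- The point of `E_m` that a point `x` of `E_0` lying on level `m` is (junk if `x` does not lie
on level `m`). -/
noncomputable def lift (E : ScBanach.{u}) (m : ℕ) (x : E.lvl 0) : E.lvl m :=
  Function.invFun (E.toBase m) x

/-- The part `U_m = U ∩ E_m` of a set `U ⊆ E_0` in level `m`, as a subset of `E_m`. -/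
def part (E : ScBanach.{u}) (U : Set (E.lvl 0)) (m : ℕ) : Set (E.lvl m) :=
  E.toBase m ⁻¹' U

/-- The shifted scale `E¹`, with levels `(E¹)_m = E_{m+1}`. -/
noncomputable abbrev shift (E : ScBanach.{u}) : ScBanach.{u} where
  lvl m := E.lvl (m + 1)
  incl m := E.incl (m + 1)
  incl_injective m := E.incl_injective (m + 1)
  incl_compact m := E.incl_compact (m + 1)
  dense_smooth m := by
    refine (E.dense_smooth (m + 1)).mono ?_
    rintro x ⟨s, hs, rfl⟩
    exact ⟨fun k => s (k + 1), fun k => hs (k + 1), rfl⟩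

/-- The sc-direct sum `E ⊕ F`, with levels `E_m ⊕ F_m`. -/
noncomputable abbrev prod (E : ScBanach.{u}) (F : ScBanach.{v}) : ScBanach.{max u v} where
  lvl m := E.lvl m × F.lvl m
  incl m := (E.incl m).prodMap (F.incl m)
  incl_injective m := (E.incl_injective m).prodMap (F.incl_injective m)
  incl_compact m := by
    obtain ⟨K, hK, hK'⟩ := E.incl_compact m
    obtain ⟨L, hL, hL'⟩ := F.incl_compact m
    exact ⟨K ×ˢ L, hK.prod hL, prod_mem_nhds hK' hL'⟩
  dense_smooth m := by
    refine ((E.dense_smooth m).prod (F.dense_smooth m)).mono ?_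
    rintro ⟨x, y⟩ ⟨⟨s, hs, hx⟩, ⟨t, ht, hy⟩⟩
    exact ⟨fun k => (s k, t k), fun k => Prod.ext (hs k) (ht k), Prod.ext hx hy⟩

/-- The finite dimensional (hence constant) Banach scale `ℝⁿ`. -/
noncomputable abbrev euclid (n : ℕ) : ScBanach.{0} where
  lvl _ := EuclideanSpace ℝ (Fin n)
  incl _ := ContinuousLinearMap.id ℝ _
  incl_injective _ := Function.injective_id
  incl_compact _ := ⟨Metric.closedBall 0 1, isCompact_closedBall 0 1,
    Metric.closedBall_mem_nhds 0 one_pos⟩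
  dense_smooth _ := by
    refine dense_univ.mono ?_
    rintro x -
    exact ⟨fun _ => x, fun _ => rfl, rfl⟩

/-- The tangent bundle `TE = E¹ ⊕ E⁰` of a Banach scale. -/
noncomputable abbrev tangent (E : ScBanach.{u}) : ScBanach.{u} := E.shift.prod E

end ScBanach

/-- An sc-isomorphism: a linear bijection which, with its inverse, preserves levels and is
continuous on every level. -/
structure ScIso (E : ScBanach.{u}) (F : ScBanach.{v}) where
  onLevel : ∀ m, E.lvl m ≃L[ℝ] F.lvl m
  comm : ∀ m x, onLevel m (E.incl m x) = F.incl m (onLevel (m + 1) x)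

/-- `C ⊆ E` is a partial quadrant: an sc-isomorphism `E ≅ ℝⁿ ⊕ W` takes `C` to `[0,∞)ⁿ ⊕ W`.
(Such a set is automatically closed and convex.) -/
def IsPartialQuadrant (E : ScBanach.{u}) (C : Set (E.lvl 0)) : Prop :=
  ∃ (n : ℕ) (W : ScBanach.{u}) (T : ScIso E ((ScBanach.euclid n).prod W)),
    C = {x | ∀ i, 0 ≤ (T.onLevel 0 x).1 i}

/-- `U` is a relatively open subset of `C`. -/
def IsRelOpen {E : ScBanach.{u}} (C U : Set (E.lvl 0)) : Prop :=
  ∃ W : Set (E.lvl 0), IsOpen W ∧ U = C ∩ W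

/-! ### Sc-calculus

A map `f : U → F` is represented by a function on all of `E_0`, of which only the values on `U`
matter. -/

/-- The level map `f_m : E_m → F_m` (meaningful where `f` preserves level `m`). -/
noncomputable def levelMap {E : ScBanach.{u}} {F : ScBanach.{v}} (f : E.lvl 0 → F.lvl 0) (m : ℕ) :
    E.lvl m → F.lvl m :=
  fun x => F.lift m (f (E.toBase m x))

/-- Class `sc⁰`: on `U`, the map `f` preserves levels and all its level maps are continuous. -/
def IsSc0 {E : ScBanach.{u}} {F : ScBanach.{v}} (U : Set (E.lvl 0)) (f : E.lvl 0 → F.lvl 0) :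
    Prop :=
  ∀ m, (∀ x ∈ E.part U m, f (E.toBase m x) ∈ range (F.toBase m)) ∧
    ContinuousOn (levelMap f m) (E.part U m)

/-- `D ∈ L(E_0, F_0)` is an sc-derivative of `f` at `x ∈ U_1`: the diagonal map `f : U_1 → F_0` is
Fréchet differentiable at `x` and `D` extends its derivative from `E_1` to `E_0`. -/
def HasScDerivAt {E : ScBanach.{u}} {F : ScBanach.{v}} (U : Set (E.lvl 0)) (f : E.lvl 0 → F.lvl 0)
    (D : E.lvl 0 →L[ℝ] F.lvl 0) (x : E.lvl 1) : Prop :=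
  HasFDerivWithinAt (fun z : E.lvl 1 => f (E.toBase 1 z)) (D.comp (E.toBase 1)) (E.part U 1) x

/-- The sc-derivative `Df(x)` (unique if it exists and `U` is relatively open in a partial
quadrant). -/
noncomputable def scDeriv {E : ScBanach.{u}} {F : ScBanach.{v}} (U : Set (E.lvl 0))
    (f : E.lvl 0 → F.lvl 0) (x : E.lvl 1) : E.lvl 0 →L[ℝ] F.lvl 0 :=
  Classical.epsilon fun D => HasScDerivAt U f D x

/-- The tangent bundle `TU = U¹ ⊕ E⁰` of a set `U ⊆ E_0`. -/
def tangentSet {E : ScBanach.{u}} (U : Set (E.lvl 0)) : Set (E.tangent.lvl 0) :=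
  {p | p.1 ∈ E.part U 1}

/-- The tangent map `Tf(x, ξ) = (f(x), Df(x)ξ)`. -/
noncomputable def scTangentMap {E : ScBanach.{u}} {F : ScBanach.{v}} (U : Set (E.lvl 0))
    (f : E.lvl 0 → F.lvl 0) : E.tangent.lvl 0 → F.tangent.lvl 0 :=
  fun p => (levelMap f 1 p.1, scDeriv U f p.1 p.2)

/-- Class `sc¹`. -/
def IsSc1 {E : ScBanach.{u}} {F : ScBanach.{v}} (U : Set (E.lvl 0)) (f : E.lvl 0 → F.lvl 0) :
    Prop :=
  IsSc0 U f ∧ (∀ x ∈ E.part U 1, ∃ D, HasScDerivAt U f D x) ∧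
    IsSc0 (tangentSet U) (scTangentMap U f)

/-- Class `scᵏ`: `f` is `sc^{k+1}` if it is `sc¹` and `Tf` is `scᵏ`. -/
def IsSc : ℕ → ∀ {E : ScBanach.{u}} {F : ScBanach.{v}}, Set (E.lvl 0) →
    (E.lvl 0 → F.lvl 0) → Prop
  | 0, _, _, U, f => IsSc0 U f
  | k + 1, _, _, U, f => IsSc1 U f ∧ IsSc k (tangentSet U) (scTangentMap U f)

/-- Sc-smooth maps on `U`. -/
def IsScSmooth {E : ScBanach.{u}} {F : ScBanach.{v}} (U : Set (E.lvl 0)) (f : E.lvl 0 → F.lvl 0) :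
    Prop :=
  ∀ k, IsSc k U f

/-! ### Sc-retracts -/

/-- `r : U → U` is an sc-smooth retraction, on a relatively open subset `U` of `C`, with image
`O`. -/
def IsRetractionOnto {E : ScBanach.{u}} (C O U : Set (E.lvl 0)) (r : E.lvl 0 → E.lvl 0) : Prop :=
  IsRelOpen C U ∧ MapsTo r U U ∧ (∀ x ∈ U, r (r x) = r x) ∧ IsScSmooth U r ∧ r '' U = O

/-- `(O, C, E)` is an sc-retract. -/
def IsScRetract (E : ScBanach.{u}) (C O : Set (E.lvl 0)) : Prop :=
  IsPartialQuadrant E C ∧ ∃ U r, IsRetractionOnto C O U r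

/-- `f` is sc-smooth on the sc-retract `(O, C, E)`: its decompression `f ∘ r` is sc-smooth for some
sc-smooth retraction `r` with image `O`. -/
def IsScSmoothOnRetract {E : ScBanach.{u}} {F : ScBanach.{v}} (C O : Set (E.lvl 0))
    (f : E.lvl 0 → F.lvl 0) : Prop :=
  IsPartialQuadrant E C ∧ ∃ U r, IsRetractionOnto C O U r ∧ IsScSmooth U (f ∘ r)

/-- The tangent bundle `TO = Tr(TU) = Fix Tr` of an sc-retract `O = r(U)`
(independent of the retraction). -/
def tangentRetract {E : ScBanach.{u}} (C O : Set (E.lvl 0)) : Set (E.tangent.lvl 0) :=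
  {p | ∃ U r, IsRetractionOnto C O U r ∧ p ∈ tangentSet U ∧ scTangentMap U r p = p}

/-- `Df(x) ξ = η` for an sc-smooth map `f` on an sc-retract `O`, at `x ∈ O_1`, `ξ ∈ T_x O`: this
derivative is that of a decompression `f ∘ r` (independent of the retraction). -/
def HasRetractDeriv {E : ScBanach.{u}} {F : ScBanach.{v}} (C O : Set (E.lvl 0))
    (f : E.lvl 0 → F.lvl 0) (x : E.lvl 1) (ξ : E.lvl 0) (η : F.lvl 0) : Prop :=
  ∃ U r, IsRetractionOnto C O U r ∧ IsScSmooth U (f ∘ r) ∧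
    (x, ξ) ∈ tangentRetract C O ∧ scDeriv U (f ∘ r) x ξ = η

/-! ### M-polyfolds -/

/-- The data `(V, φ, (O, C, E))` of an M-polyfold chart on `X`; the map `φ` is given on all of `X`,
but only its values on `V = dom` matter. -/
structure MChart (X : Type v) where
  dom : Set X
  E : ScBanach.{u}
  C : Set (E.lvl 0)
  O : Set (E.lvl 0)
  toFun : X → E.lvl 0

/-- `(V, φ, (O, C, E))` is an M-polyfold chart: `V` is open, `(O, C, E)` is an sc-retract, and `φ`
restricts to a homeomorphism `V → O`. -/
def MChart.IsChart {X : Type v} [TopologicalSpace X] (φ : MChart.{u} X) : Prop :=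
  IsOpen φ.dom ∧ IsScRetract φ.E φ.C φ.O ∧ φ.toFun '' φ.dom = φ.O ∧
    IsEmbedding (φ.dom.domRestrict φ.toFun)

/-- The local representative `ψ ∘ f ∘ φ⁻¹` of `f : X → Y`, on `φ(V ∩ f⁻¹ V')`. -/
noncomputable def localRep {X : Type v} {Y : Type w} (φ : MChart.{u} X) (ψ : MChart.{u} Y)
    (f : X → Y) : φ.E.lvl 0 → ψ.E.lvl 0 :=
  fun y => Classical.epsilon fun z => ∃ x ∈ φ.dom, φ.toFun x = y ∧ z = ψ.toFun (f x)

/-- The domain `φ(V ∩ V')` of the transition map `φ' ∘ φ⁻¹`. -/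
def overlap {X : Type v} (φ φ' : MChart.{u} X) : Set (φ.E.lvl 0) :=
  φ.toFun '' (φ.dom ∩ φ'.dom)

/-- The transition map `φ' ∘ φ⁻¹`, on `φ(V ∩ V')`. -/
noncomputable def transition {X : Type v} (φ φ' : MChart.{u} X) : φ.E.lvl 0 → φ'.E.lvl 0 :=
  localRep φ φ' id

/-- Sc-smooth compatibility: the transition map and its inverse are sc-smooth retract maps. -/
def Compatible {X : Type v} (φ φ' : MChart.{u} X) : Prop :=
  IsScSmoothOnRetract φ.C (overlap φ φ') (transition φ φ') ∧
    IsScSmoothOnRetract φ'.C (overlap φ' φ) (transition φ' φ)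

/-- `𝒜` is an M-polyfold atlas for `X`. -/
def IsAtlas {X : Type v} [TopologicalSpace X] (𝒜 : Set (MChart.{u} X)) : Prop :=
  (∀ φ ∈ 𝒜, φ.IsChart) ∧ (∀ φ ∈ 𝒜, ∀ ψ ∈ 𝒜, Compatible φ ψ) ∧ ∀ x, ∃ φ ∈ 𝒜, x ∈ φ.dom

/-- Two atlases are equivalent if their union is an atlas. -/
def EquivAtlas {X : Type v} [TopologicalSpace X] (𝒜 𝒜' : Set (MChart.{u} X)) : Prop :=
  IsAtlas 𝒜 ∧ IsAtlas 𝒜' ∧ IsAtlas (𝒜 ∪ 𝒜')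

/-- `X` with (the equivalence class of) the atlas `𝒜` is an M-polyfold. -/
def IsMPolyfold {X : Type v} [TopologicalSpace X] (𝒜 : Set (MChart.{u} X)) : Prop :=
  T2Space X ∧ ParacompactSpace X ∧ IsAtlas 𝒜

/-- The M-polyfold charts of `(X, 𝒜)`: the charts that belong to an atlas equivalent to `𝒜`. -/
def mCharts {X : Type v} [TopologicalSpace X] (𝒜 : Set (MChart.{u} X)) : Set (MChart.{u} X) :=
  {φ | ∃ 𝒜', EquivAtlas 𝒜 𝒜' ∧ φ ∈ 𝒜'}

/-- `f` is an sc-smooth map between M-polyfolds: it is continuous and each of its representatives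
`ψ ∘ f ∘ φ⁻¹` in M-polyfold charts is an sc-smooth retract map on `φ(V ∩ f⁻¹ V')`. -/
def IsScSmoothMap {X : Type v} [TopologicalSpace X] (𝒜 : Set (MChart.{u} X))
    {Y : Type w} [TopologicalSpace Y] (ℬ : Set (MChart.{u} Y)) (f : X → Y) : Prop :=
  Continuous f ∧ ∀ φ ∈ mCharts 𝒜, ∀ ψ ∈ mCharts ℬ,
    IsScSmoothOnRetract φ.C (φ.toFun '' (φ.dom ∩ f ⁻¹' ψ.dom)) (localRep φ ψ f)

/-- Sc-smooth diffeomorphisms between M-polyfolds. -/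
def IsScDiffeo {X : Type v} [TopologicalSpace X] (𝒜 : Set (MChart.{u} X))
    {Y : Type w} [TopologicalSpace Y] (ℬ : Set (MChart.{u} Y)) (e : X ≃ Y) : Prop :=
  IsScSmoothMap 𝒜 ℬ e ∧ IsScSmoothMap ℬ 𝒜 e.symm

/-! ### The shifted M-polyfold `X¹` -/

/-- Level `m` of `X`: the points that some chart maps to level `m`. -/
def levelSet {X : Type v} (𝒜 : Set (MChart.{u} X)) (m : ℕ) : Set X :=
  {x | ∃ φ ∈ 𝒜, x ∈ φ.dom ∧ φ.toFun x ∈ range (φ.E.toBase m)}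

/-- The set underlying `X¹`; its topology is not the subspace topology of `X`. -/
def Shifted {X : Type v} (𝒜 : Set (MChart.{u} X)) : Type v := {x : X // x ∈ levelSet 𝒜 1}

/-- The chart `φ : V ∩ X_1 → O¹ ⊆ C¹ ⊆ E¹` of `X¹` given by a chart `φ` of `X`. -/
noncomputable def shiftedChart {X : Type v} (𝒜 : Set (MChart.{u} X)) (φ : MChart.{u} X) :
    MChart.{u} (Shifted 𝒜) where
  dom := {x | x.1 ∈ φ.dom}
  E := φ.E.shift
  C := φ.E.part φ.C 1
  O := φ.E.part φ.O 1
  toFun x := φ.E.lift 1 (φ.toFun x.1)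

/-- The induced atlas of `X¹`. -/
def shiftedAtlas {X : Type v} (𝒜 : Set (MChart.{u} X)) : Set (MChart.{u} (Shifted 𝒜)) :=
  shiftedChart 𝒜 '' 𝒜

/-- The collection of all preimages of open sets under the charts in `𝒜`. -/
def chartPreimages {X : Type v} (𝒜 : Set (MChart.{u} X)) : Set (Set X) :=
  {B | ∃ φ ∈ 𝒜, ∃ W : Set (φ.E.lvl 0), IsOpen W ∧ B = φ.dom ∩ φ.toFun ⁻¹' W}

instance {X : Type v} (𝒜 : Set (MChart.{u} X)) : TopologicalSpace (Shifted 𝒜) :=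
  TopologicalSpace.generateFrom (chartPreimages (shiftedAtlas 𝒜))

/-! ### The tangent bundle `TX` -/

/-- A tuple `(x, V, φ, (O, C, E), ξ)`: a chart `φ ∈ 𝒜` about a point `x` on level `1` and a tangent
vector `ξ ∈ T_{φ(x)} O`. The field `base` is the point `φ(x)`, seen in `E_1`. -/
structure TangentTuple {X : Type v} (𝒜 : Set (MChart.{u} X)) where
  chart : MChart.{u} X
  chart_mem : chart ∈ 𝒜
  pt : X
  pt_mem : pt ∈ chart.dom
  base : chart.E.lvl 1
  base_eq : chart.E.toBase 1 base = chart.toFun pt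
  vec : chart.E.lvl 0
  vec_mem : (base, vec) ∈ tangentRetract chart.C chart.O

/-- `(x, φ, ξ) ∼ (x', φ', ξ')`: that is, `x = x'` and `D(φ' ∘ φ⁻¹)(φ(x)) ξ = ξ'`. -/
def Related {X : Type v} {𝒜 𝒜' : Set (MChart.{u} X)} (t : TangentTuple 𝒜) (t' : TangentTuple 𝒜') :
    Prop :=
  t.pt = t'.pt ∧ HasRetractDeriv t.chart.C (overlap t.chart t'.chart)
    (transition t.chart t'.chart) t.base t.vec t'.vec

/-- The set `TX` of equivalence classes of tuples. -/
def MTangent {X : Type v} (𝒜 : Set (MChart.{u} X)) : Type (max v (u + 1)) :=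
  Quot (Related : TangentTuple 𝒜 → TangentTuple 𝒜 → Prop)

/-- The class `[x, φ, ξ]`. -/
def MTangent.mk {X : Type v} {𝒜 : Set (MChart.{u} X)} (t : TangentTuple 𝒜) :
    MTangent 𝒜 :=
  Quot.mk _ t

/-- The natural projection `p : TX → X¹`, `[x, φ, ξ] ↦ x`. -/
def MTangent.proj {X : Type v} {𝒜 : Set (MChart.{u} X)} : MTangent 𝒜 → Shifted 𝒜 :=
  Quot.lift (fun t => ⟨t.pt, t.chart, t.chart_mem, t.pt_mem, t.base, t.base_eq⟩)
    fun _ _ h => Subtype.ext h.1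

/-- `v = [x, φ, ξ]` and `q = (φ(x), ξ)`. -/
def IsTangentCoord {X : Type v} {𝒜 : Set (MChart.{u} X)} (φ : MChart.{u} X)
    (v : MTangent 𝒜) (q : φ.E.tangent.lvl 0) : Prop :=
  ∃ (hφ : φ ∈ 𝒜) (x : X) (hx : x ∈ φ.dom) (hq : φ.E.toBase 1 q.1 = φ.toFun x)
    (hT : (q.1, q.2) ∈ tangentRetract φ.C φ.O),
    v = MTangent.mk ⟨φ, hφ, x, hx, q.1, hq, q.2, hT⟩

/-- The chart `(TV, Tφ, (TO, TC, TE))` of `TX`, where `TV = p⁻¹(V ∩ X_1)` and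
`Tφ [x, φ, ξ] = (φ(x), ξ)`. -/
noncomputable def tangentChart {X : Type v} (𝒜 : Set (MChart.{u} X)) (φ : MChart.{u} X) :
    MChart.{u} (MTangent 𝒜) where
  dom := {v | (MTangent.proj v).1 ∈ φ.dom}
  E := φ.E.tangent
  C := tangentSet φ.C
  O := tangentRetract φ.C φ.O
  toFun v := Classical.epsilon fun q => IsTangentCoord φ v q

/-- The induced atlas `T𝒜` of `TX`. -/
def tangentAtlas {X : Type v} (𝒜 : Set (MChart.{u} X)) : Set (MChart.{u} (MTangent 𝒜)) :=
  tangentChart 𝒜 '' 𝒜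

instance {X : Type v} (𝒜 : Set (MChart.{u} X)) : TopologicalSpace (MTangent 𝒜) :=
  TopologicalSpace.generateFrom (chartPreimages (tangentAtlas 𝒜))

end ScCalculus

open ScCalculus

/-! Everything rests on the functoriality `T(g ∘ f) = Tg ∘ Tf` of the tangent map, from which
retracts, transition maps and finally whole atlases can be differentiated formally.

The analytic obstacle is that the sc-derivative is only jointly continuous in the point and the
vector, not continuous in operator norm. Compactness of the inclusions compensates: an increment
that passes through `E_1 → E_0` has, after division by its length, its limit points in a compact
set, and on compact sets joint continuity is uniform
(`eventually_norm_sub_le_of_isCompactOperator`). This gives the chain rule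
`IsSc1.hasScDerivAt_comp`. For `X¹` one also needs that an sc-smooth map stays sc-smooth after
raising all levels by one (`IsSc1.hasScDerivAt_shift`); there differentiability is known only in the
weaker norm, and is improved by integrating the derivative along segments.

Functoriality turns `r ∘ r = r` into `Tr ∘ Tr = Tr`, so `TO` is an sc-retract, independent of `r`.
It turns the cocycle identities of the transition maps into the equivalence relation on tuples, and
makes the transition maps of `TX` the tangents of those of `X`. Bijections onto retracts with open
overlaps and sc-smooth transitions glue to an atlas (`isTopologicalBasis_and_isAtlas_of_gluing`).

Hausdorffness and paracompactness are inherited from `X` along the continuous maps `TX → X¹ → X`: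
the preimage of a chart domain is a chart domain, which embeds in a Banach space and is therefore
metrizable (`t2Space_and_paracompactSpace_of_charts`).

Most lemmas on tuples and transitions refer to an ambient atlas `𝒰` containing the atlases in play.
Taking `𝒰 = 𝒜` gives the structure on `TX`, and `𝒰 = 𝒜 ∪ 𝒜'` gives its independence of the atlas. -/

namespace ScCalculus

open Filter

/-! ### Levels of a Banach scale -/

namespace ScBanach

variable (E : ScBanach.{u}) (F : ScBanach.{v})

theorem toBase_injective : ∀ m, Function.Injective (E.toBase m)
  | 0 => Function.injective_id
  | m + 1 => (toBase_injective m).comp (E.incl_injective m)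

@[simp]
theorem lift_toBase (m : ℕ) (x : E.lvl m) : E.lift m (E.toBase m x) = x :=
  Function.leftInverse_invFun (E.toBase_injective m) x

theorem toBase_lift {m : ℕ} {x : E.lvl 0} (h : x ∈ range (E.toBase m)) :
    E.toBase m (E.lift m x) = x :=
  Function.invFun_eq h

theorem toBase_shift (m : ℕ) (x : E.lvl (m + 1)) :
    E.toBase 1 (E.shift.toBase m x) = E.toBase (m + 1) x := by
  induction m with
  | zero => rfl
  | succ m ih => exact ih (E.incl (m + 1) x)

theorem toBase_prod (m : ℕ) (x : E.lvl m × F.lvl m) :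
    (E.prod F).toBase m x = (E.toBase m x.1, F.toBase m x.2) := by
  induction m with
  | zero => rfl
  | succ m ih => exact ih (E.incl m x.1, F.incl m x.2)

theorem toBase_tangent (m : ℕ) (x : E.lvl (m + 1) × E.lvl m) :
    E.tangent.toBase m x = (E.shift.toBase m x.1, E.toBase m x.2) :=
  toBase_prod _ _ _ _

theorem denseRange_toBase_one : DenseRange (E.toBase 1) := by
  refine (E.dense_smooth 0).mono ?_
  rintro x ⟨s, hs, rfl⟩
  exact ⟨s 1, hs 0⟩

theorem isCompactOperator_toBase_one : IsCompactOperator (E.toBase 1) := E.incl_compact 0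

theorem mem_part {U : Set (E.lvl 0)} {m : ℕ} {x : E.lvl m} :
    x ∈ E.part U m ↔ E.toBase m x ∈ U := Iff.rfl

theorem part_shift (U : Set (E.lvl 0)) (m : ℕ) :
    E.shift.part (E.part U 1) m = E.part U (m + 1) := by
  ext x
  exact iff_of_eq (congrArg (· ∈ U) (E.toBase_shift m x))

theorem isOpen_part {U : Set (E.lvl 0)} (h : IsOpen U) (m : ℕ) : IsOpen (E.part U m) :=
  h.preimage (E.toBase m).continuous

theorem part_inter (U V : Set (E.lvl 0)) (m : ℕ) : E.part (U ∩ V) m = E.part U m ∩ E.part V m :=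
  rfl

theorem part_tangentSet (U : Set (E.lvl 0)) (m : ℕ) :
    E.tangent.part (tangentSet U) m = E.part U (m + 1) ×ˢ univ := by
  ext ⟨x, ξ⟩
  have h1 : (E.tangent.toBase m (x, ξ)).1 = E.shift.toBase m x :=
    congrArg Prod.fst (E.toBase_tangent m (x, ξ))
  have h2 : E.toBase 1 (E.tangent.toBase m (x, ξ)).1 = E.toBase (m + 1) x :=
    (congrArg (E.toBase 1) h1).trans (E.toBase_shift m x)
  exact (iff_of_eq (congrArg (· ∈ U) h2)).trans ⟨fun h => ⟨h, trivial⟩, fun h => h.1⟩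

end ScBanach

variable {E : ScBanach.{u}} {F : ScBanach.{v}} {G : ScBanach.{w}}

/-! ### Partial quadrants and their relatively open subsets -/

theorem IsPartialQuadrant.shift {C : Set (E.lvl 0)} (h : IsPartialQuadrant E C) :
    IsPartialQuadrant E.shift (E.part C 1) := by
  obtain ⟨n, W, T, rfl⟩ := h
  refine ⟨n, W.shift, ⟨fun m => T.onLevel (m + 1), fun m x => T.comm (m + 1) x⟩, ?_⟩
  ext x
  change (∀ i, 0 ≤ (T.onLevel 0 (E.incl 0 x)).1 i) ↔ ∀ i, 0 ≤ (T.onLevel 1 x).1 i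
  rw [T.comm]
  rfl

/-- Only the base point is constrained, so the `[0,∞)ⁿ` factor comes from `E¹` alone; the copy of
`ℝⁿ` in the vector component joins the unconstrained complement `W¹ ⊕ (ℝⁿ ⊕ W)`. -/
theorem IsPartialQuadrant.tangent {C : Set (E.lvl 0)} (h : IsPartialQuadrant E C) :
    IsPartialQuadrant E.tangent (tangentSet C) := by
  obtain ⟨n, W, T, rfl⟩ := h
  refine ⟨n, W.shift.prod ((ScBanach.euclid n).prod W),
    ⟨fun m => ((T.onLevel (m + 1)).prodCongr (T.onLevel m)).trans
      (ContinuousLinearEquiv.prodAssoc ℝ _ _ _), fun m x => ?_⟩, ?_⟩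
  · have h1 := T.comm (m + 1) x.1
    have h2 := T.comm m x.2
    refine Prod.ext ?_ (Prod.ext ?_ ?_)
    · exact congrArg (fun q : (ScBanach.euclid n).lvl (m + 1) × W.lvl (m + 1) => q.1) h1
    · exact congrArg (fun q : (ScBanach.euclid n).lvl (m + 1) × W.lvl (m + 1) => q.2) h1
    · exact h2
  · ext x
    change (∀ i, 0 ≤ (T.onLevel 0 (E.incl 0 x.1)).1 i) ↔ ∀ i, 0 ≤ (T.onLevel 1 x.1).1 i
    rw [T.comm]
    rfl

theorem IsPartialQuadrant.convex {C : Set (E.lvl 0)} (h : IsPartialQuadrant E C) :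
    Convex ℝ C := by
  obtain ⟨n, W, T, rfl⟩ := h
  intro x hx y hy a b ha hb _ i
  have h1 := hx i
  have h2 := hy i
  simp only [map_add, map_smul, Prod.fst_add, Prod.smul_fst, PiLp.add_apply, PiLp.smul_apply,
    smul_eq_mul]
  positivity

theorem IsPartialQuadrant.interior_nonempty {C : Set (E.lvl 0)} (h : IsPartialQuadrant E C) :
    (interior C).Nonempty := by
  obtain ⟨n, W, T, rfl⟩ := h
  refine ⟨(T.onLevel 0).symm (WithLp.toLp 2 (fun _ => 1), 0), ?_⟩
  refine mem_interior.2 ⟨{x | ∀ i, 0 < (T.onLevel 0 x).1 i}, fun x hx i => (hx i).le, ?_, ?_⟩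
  · simp only [ofPred_forall]
    refine isOpen_iInter_of_finite fun i => isOpen_lt continuous_const ?_
    have h1 : Continuous fun x : E.lvl 0 => (T.onLevel 0 x).1 :=
      continuous_fst.comp (T.onLevel 0).continuous
    exact (PiLp.continuous_apply 2 _ i).comp h1
  · intro i
    simp

/-- A relatively open subset of some partial quadrant. -/
def IsScDomain (U : Set (E.lvl 0)) : Prop :=
  ∃ C, IsPartialQuadrant E C ∧ IsRelOpen C U

theorem IsRelOpen.shift {C U : Set (E.lvl 0)} (h : IsRelOpen C U) :
    IsRelOpen (E := E.shift) (E.part C 1) (E.part U 1) := by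
  obtain ⟨W, hW, rfl⟩ := h
  exact ⟨E.part W 1, E.isOpen_part hW 1, rfl⟩

theorem isOpen_tangentSet {W : Set (E.lvl 0)} (hW : IsOpen W) : IsOpen (tangentSet W) :=
  (E.isOpen_part hW 1).preimage continuous_fst

theorem IsRelOpen.tangent {C U : Set (E.lvl 0)} (h : IsRelOpen C U) :
    IsRelOpen (tangentSet C) (tangentSet U) := by
  obtain ⟨W, hW, rfl⟩ := h
  exact ⟨tangentSet W, isOpen_tangentSet hW, rfl⟩

theorem IsRelOpen.inter_open {C U W : Set (E.lvl 0)} (h : IsRelOpen C U) (hW : IsOpen W) :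
    IsRelOpen C (U ∩ W) := by
  obtain ⟨W', hW', rfl⟩ := h
  exact ⟨W' ∩ W, hW'.inter hW, inter_assoc _ _ _⟩

theorem IsScDomain.shift {U : Set (E.lvl 0)} (h : IsScDomain U) :
    IsScDomain (E := E.shift) (E.part U 1) := by
  obtain ⟨C, hC, hU⟩ := h
  exact ⟨_, hC.shift, hU.shift⟩

theorem IsScDomain.tangent {U : Set (E.lvl 0)} (h : IsScDomain U) : IsScDomain (tangentSet U) := by
  obtain ⟨C, hC, hU⟩ := h
  exact ⟨_, hC.tangent, hU.tangent⟩

theorem IsScDomain.inter_open {U W : Set (E.lvl 0)} (h : IsScDomain U) (hW : IsOpen W) :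
    IsScDomain (U ∩ W) := by
  obtain ⟨C, hC, hU⟩ := h
  exact ⟨_, hC, hU.inter_open hW⟩

theorem IsScDomain.uniqueDiffOn {U : Set (E.lvl 0)} (h : IsScDomain U) : UniqueDiffOn ℝ U := by
  obtain ⟨C, hC, W, hW, rfl⟩ := h
  exact (uniqueDiffOn_convex hC.convex hC.interior_nonempty).inter hW

theorem IsScDomain.uniqueDiffOn_part_one {U : Set (E.lvl 0)} (h : IsScDomain U) :
    UniqueDiffOn ℝ (E.part U 1) :=
  h.shift.uniqueDiffOn

/-- Convexity of the quadrant makes a relatively open set star-shaped near each of its points, as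
needed to apply mean value estimates along segments. -/
theorem IsScDomain.exists_ball_segment {U : Set (E.lvl 0)} (h : IsScDomain U) {x : E.lvl 0}
    (hx : x ∈ U) : ∃ δ > 0, ∀ y ∈ U ∩ Metric.ball x δ,
      segment ℝ x y ⊆ U ∩ Metric.ball x δ := by
  obtain ⟨C, hC, W, hW, rfl⟩ := h
  obtain ⟨δ, hδ, hb⟩ := Metric.isOpen_iff.1 hW x hx.2
  refine ⟨δ, hδ, fun y hy z hz => ?_⟩
  have h1 := (convex_ball x δ).segment_subset (Metric.mem_ball_self hδ) hy.2 hz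
  exact ⟨⟨hC.convex.segment_subset hx.1 hy.1.1 hz, hb h1⟩, h1⟩

/-! ### Maps of class `sc⁰` -/

theorem IsSc0.toBase_levelMap {U : Set (E.lvl 0)} {f : E.lvl 0 → F.lvl 0} (h : IsSc0 U f) {m : ℕ}
    {x : E.lvl m} (hx : x ∈ E.part U m) : F.toBase m (levelMap f m x) = f (E.toBase m x) :=
  F.toBase_lift ((h m).1 x hx)

theorem levelMap_zero (f : E.lvl 0 → F.lvl 0) : levelMap f 0 = f := by
  ext x
  exact F.lift_toBase 0 (f x)

theorem levelMap_eq {f : E.lvl 0 → F.lvl 0} {m : ℕ} {x : E.lvl m} {y : F.lvl m}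
    (h : F.toBase m y = f (E.toBase m x)) : levelMap f m x = y := by
  rw [levelMap, ← h, F.lift_toBase]

/-- Exhibiting the level maps explicitly avoids all reasoning about the junk values of `lift`. -/
theorem isSc0_of_levels {U : Set (E.lvl 0)} {f : E.lvl 0 → F.lvl 0} (g : ∀ m, E.lvl m → F.lvl m)
    (hg : ∀ m, ContinuousOn (g m) (E.part U m))
    (h : ∀ m, ∀ x ∈ E.part U m, F.toBase m (g m x) = f (E.toBase m x)) : IsSc0 U f := fun m =>
  ⟨fun x hx => ⟨_, h m x hx⟩, (hg m).congr fun x hx => levelMap_eq (h m x hx)⟩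

theorem IsSc0.continuousOn {U : Set (E.lvl 0)} {f : E.lvl 0 → F.lvl 0} (h : IsSc0 U f) :
    ContinuousOn f U := by
  have := (h 0).2
  rwa [levelMap_zero] at this

theorem IsSc0.mapsTo_levelMap {U : Set (E.lvl 0)} {V : Set (F.lvl 0)} {f : E.lvl 0 → F.lvl 0}
    (h : IsSc0 U f) (hm : MapsTo f U V) (m : ℕ) :
    MapsTo (levelMap f m) (E.part U m) (F.part V m) := fun x hx => by
  rw [ScBanach.mem_part, h.toBase_levelMap hx]
  exact hm hx

theorem IsSc0.levelMap_comp {U : Set (E.lvl 0)} {f : E.lvl 0 → F.lvl 0}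
    {g : F.lvl 0 → G.lvl 0} (hf : IsSc0 U f) {m : ℕ} {x : E.lvl m} (hx : x ∈ E.part U m) :
    levelMap (g ∘ f) m x = levelMap g m (levelMap f m x) := by
  simp only [levelMap, Function.comp]
  rw [F.toBase_lift ((hf m).1 x hx)]

theorem IsSc0.comp {U : Set (E.lvl 0)} {V : Set (F.lvl 0)} {f : E.lvl 0 → F.lvl 0}
    {g : F.lvl 0 → G.lvl 0} (hg : IsSc0 V g) (hf : IsSc0 U f) (hm : MapsTo f U V) :
    IsSc0 U (g ∘ f) := by
  refine isSc0_of_levels (fun m => levelMap g m ∘ levelMap f m)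
    (fun m => (hg m).2.comp (hf m).2 (hf.mapsTo_levelMap hm m)) fun m x hx => ?_
  rw [Function.comp, hg.toBase_levelMap (hf.mapsTo_levelMap hm m hx), hf.toBase_levelMap hx]
  rfl

theorem IsSc0.congr {U : Set (E.lvl 0)} {f g : E.lvl 0 → F.lvl 0} (hf : IsSc0 U f)
    (h : EqOn f g U) : IsSc0 U g :=
  isSc0_of_levels (fun m => levelMap f m) (fun m => (hf m).2) fun m x hx => by
    rw [hf.toBase_levelMap hx, h hx]

theorem levelMap_congr {U : Set (E.lvl 0)} {f g : E.lvl 0 → F.lvl 0} (h : EqOn f g U) (m : ℕ) :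
    EqOn (levelMap f m) (levelMap g m) (E.part U m) := fun x hx => by
  rw [levelMap, levelMap, h hx]

theorem IsSc0.shift {U : Set (E.lvl 0)} {f : E.lvl 0 → F.lvl 0} (hf : IsSc0 U f) :
    IsSc0 (E := E.shift) (F := F.shift) (E.part U 1) (levelMap f 1) := by
  refine isSc0_of_levels (E := E.shift) (F := F.shift) (fun m => levelMap f (m + 1)) (fun m => ?_)
    fun m x hx => ?_
  · rw [ScBanach.part_shift]
    exact (hf (m + 1)).2
  · rw [ScBanach.part_shift] at hx
    apply F.toBase_injective 1
    rw [ScBanach.toBase_shift, hf.toBase_levelMap hx, hf.toBase_levelMap, ScBanach.toBase_shift]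
    rw [ScBanach.mem_part, ScBanach.toBase_shift]
    exact hx

theorem levelMap_shift {U : Set (E.lvl 0)} {f : E.lvl 0 → F.lvl 0} (hf : IsSc0 U f) {m : ℕ}
    {x : E.lvl (m + 1)} (hx : x ∈ E.part U (m + 1)) :
    levelMap (E := E.shift) (F := F.shift) (levelMap f 1) m x = levelMap f (m + 1) x := by
  apply levelMap_eq
  apply F.toBase_injective 1
  rw [ScBanach.toBase_shift, hf.toBase_levelMap hx, hf.toBase_levelMap, ScBanach.toBase_shift]
  rw [ScBanach.mem_part, ScBanach.toBase_shift]
  exact hx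

theorem isSc0_of_local {U : Set (E.lvl 0)} {f : E.lvl 0 → F.lvl 0}
    (h : ∀ x ∈ U, ∃ W, IsOpen W ∧ x ∈ W ∧ IsSc0 (U ∩ W) f) : IsSc0 U f := by
  refine fun m => ⟨fun x hx => ?_, fun x hx => ?_⟩
  · obtain ⟨W, hW, hxW, hf⟩ := h _ hx
    exact (hf m).1 x ⟨hx, hxW⟩
  · obtain ⟨W, hW, hxW, hf⟩ := h _ hx
    have := (hf m).2 x ⟨hx, hxW⟩
    rw [ScBanach.part_inter] at this
    exact (continuousWithinAt_inter ((E.isOpen_part hW m).mem_nhds hxW)).1 this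

/-! ### Sc-derivatives -/

/-- Unique differentiability on the domain fixes the operator on `E_1`, and density of `E_1` in
`E_0` fixes its bounded extension. -/
theorem HasScDerivAt.unique {U : Set (E.lvl 0)} (hU : IsScDomain U) {f : E.lvl 0 → F.lvl 0}
    {D D' : E.lvl 0 →L[ℝ] F.lvl 0} {x : E.lvl 1} (hx : x ∈ E.part U 1)
    (h : HasScDerivAt U f D x) (h' : HasScDerivAt U f D' x) : D = D' := by
  have h1 : D.comp (E.toBase 1) = D'.comp (E.toBase 1) :=
    (hU.uniqueDiffOn_part_one x hx).eq h h'
  have h2 : (D : E.lvl 0 → F.lvl 0) = D' :=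
    E.denseRange_toBase_one.equalizer D.continuous D'.continuous
      (funext fun z => DFunLike.congr_fun h1 z)
  exact DFunLike.coe_injective h2

theorem hasScDerivAt_scDeriv {U : Set (E.lvl 0)} {f : E.lvl 0 → F.lvl 0} {x : E.lvl 1}
    (h : ∃ D, HasScDerivAt U f D x) : HasScDerivAt U f (scDeriv U f x) x :=
  Classical.epsilon_spec h

theorem HasScDerivAt.scDeriv_eq {U : Set (E.lvl 0)} (hU : IsScDomain U) {f : E.lvl 0 → F.lvl 0}
    {D : E.lvl 0 →L[ℝ] F.lvl 0} {x : E.lvl 1} (hx : x ∈ E.part U 1) (h : HasScDerivAt U f D x) :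
    scDeriv U f x = D :=
  (hasScDerivAt_scDeriv ⟨D, h⟩).unique hU hx h

theorem HasScDerivAt.congr {U : Set (E.lvl 0)} {f g : E.lvl 0 → F.lvl 0} (hfg : EqOn f g U)
    {D : E.lvl 0 →L[ℝ] F.lvl 0} {x : E.lvl 1} (hx : x ∈ E.part U 1) (h : HasScDerivAt U f D x) :
    HasScDerivAt U g D x :=
  HasFDerivWithinAt.congr h (fun _ hz => (hfg hz).symm) (hfg hx).symm

theorem scDeriv_congr {U : Set (E.lvl 0)} {f g : E.lvl 0 → F.lvl 0} (hfg : EqOn f g U)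
    {x : E.lvl 1} (hx : x ∈ E.part U 1) : scDeriv U f x = scDeriv U g x := by
  unfold scDeriv
  congr 1
  ext D
  exact ⟨fun h => h.congr hfg hx, fun h => h.congr hfg.symm hx⟩

theorem scTangentMap_congr {U : Set (E.lvl 0)} {f g : E.lvl 0 → F.lvl 0} (hfg : EqOn f g U) :
    EqOn (scTangentMap U f) (scTangentMap U g) (tangentSet U) := fun p hp => by
  rw [scTangentMap, scTangentMap, scDeriv_congr hfg hp, levelMap_congr hfg 1 hp]

theorem IsSc1.congr {U : Set (E.lvl 0)} {f g : E.lvl 0 → F.lvl 0} (hf : IsSc1 U f)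
    (h : EqOn f g U) : IsSc1 U g :=
  ⟨hf.1.congr h, fun x hx => (hf.2.1 x hx).imp fun _ hD => hD.congr h hx,
    hf.2.2.congr (scTangentMap_congr h)⟩

theorem IsSc.congr {k : ℕ} {E : ScBanach.{u}} {F : ScBanach.{v}} {U : Set (E.lvl 0)}
    {f g : E.lvl 0 → F.lvl 0} (hf : IsSc k U f) (h : EqOn f g U) : IsSc k U g := by
  induction k generalizing E F with
  | zero => exact IsSc0.congr hf h
  | succ k ih => exact ⟨hf.1.congr h, ih hf.2 (scTangentMap_congr h)⟩

theorem IsScSmooth.congr {U : Set (E.lvl 0)} {f g : E.lvl 0 → F.lvl 0} (hf : IsScSmooth U f)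
    (h : EqOn f g U) : IsScSmooth U g := fun k => (hf k).congr h

theorem IsScSmooth.sc0 {U : Set (E.lvl 0)} {f : E.lvl 0 → F.lvl 0} (hf : IsScSmooth U f) :
    IsSc0 U f := hf 0

theorem IsScSmooth.sc1 {U : Set (E.lvl 0)} {f : E.lvl 0 → F.lvl 0} (hf : IsScSmooth U f) :
    IsSc1 U f := (hf 1).1

theorem IsScSmooth.tangent {U : Set (E.lvl 0)} {f : E.lvl 0 → F.lvl 0} (hf : IsScSmooth U f) :
    IsScSmooth (tangentSet U) (scTangentMap U f) := fun k => (hf (k + 1)).2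

theorem HasScDerivAt.inter_open {U W : Set (E.lvl 0)} (hW : IsOpen W) {f : E.lvl 0 → F.lvl 0}
    {D : E.lvl 0 →L[ℝ] F.lvl 0} {x : E.lvl 1} (hx : x ∈ E.part W 1) :
    HasScDerivAt (U ∩ W) f D x ↔ HasScDerivAt U f D x :=
  hasFDerivWithinAt_inter ((E.isOpen_part hW 1).mem_nhds hx)

theorem scTangentMap_inter_open {U W : Set (E.lvl 0)} (hW : IsOpen W) {f : E.lvl 0 → F.lvl 0} :
    EqOn (scTangentMap (U ∩ W) f) (scTangentMap U f) (tangentSet (U ∩ W)) := fun p hp => by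
  have : scDeriv (U ∩ W) f p.1 = scDeriv U f p.1 := by
    unfold scDeriv
    congr 1
    ext D
    exact HasScDerivAt.inter_open hW hp.2
  rw [scTangentMap, scTangentMap, this]

theorem isSc_of_local {k : ℕ} {E : ScBanach.{u}} {F : ScBanach.{v}} {U : Set (E.lvl 0)}
    {f : E.lvl 0 → F.lvl 0}
    (h : ∀ x ∈ U, ∃ W, IsOpen W ∧ x ∈ W ∧ IsSc k (U ∩ W) f) : IsSc k U f := by
  induction k generalizing E F with
  | zero => exact isSc0_of_local h
  | succ k ih =>
    -- Abstracting over `P` lets one localization argument serve both clauses on `Tf`: that it is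
    -- `sc⁰` and that it is `scᵏ`. The cylinder over an open set of base points is the required open
    -- set.
    have key : ∀ {P : Set (E.tangent.lvl 0) → (E.tangent.lvl 0 → F.tangent.lvl 0) → Prop},
        (∀ {V f g}, P V f → EqOn f g V → P V g) →
        (∀ x ∈ U, ∃ W, IsOpen W ∧ x ∈ W ∧ P (tangentSet (U ∩ W)) (scTangentMap (U ∩ W) f)) →
        ∀ p ∈ tangentSet U, ∃ W, IsOpen W ∧ p ∈ W ∧ P (tangentSet U ∩ W) (scTangentMap U f) := by
      intro P hP h p hp
      obtain ⟨W, hW, hx, hk⟩ := h _ hp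
      exact ⟨tangentSet W, isOpen_tangentSet hW, hx, hP hk (scTangentMap_inter_open hW)⟩
    refine ⟨⟨isSc0_of_local fun x hx => ?_, fun x hx => ?_, isSc0_of_local ?_⟩, ih ?_⟩
    · obtain ⟨W, hW, hx, hk⟩ := h _ hx
      exact ⟨W, hW, hx, hk.1.1⟩
    · obtain ⟨W, hW, hxW, hk⟩ := h _ hx
      obtain ⟨D, hD⟩ := hk.1.2.1 x ⟨hx, hxW⟩
      exact ⟨D, (HasScDerivAt.inter_open hW hxW).1 hD⟩
    · exact key IsSc0.congr fun x hx => (h x hx).imp fun W hW => ⟨hW.1, hW.2.1, hW.2.2.1.2.2⟩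
    · exact key IsSc.congr fun x hx => (h x hx).imp fun W hW => ⟨hW.1, hW.2.1, hW.2.2.2⟩

theorem isScSmooth_of_local {U : Set (E.lvl 0)} {f : E.lvl 0 → F.lvl 0}
    (h : ∀ x ∈ U, ∃ W, IsOpen W ∧ x ∈ W ∧ IsScSmooth (U ∩ W) f) : IsScSmooth U f := fun k =>
  isSc_of_local fun x hx => (h x hx).imp fun _ hW => ⟨hW.1, hW.2.1, hW.2.2 k⟩

/-! ### Uniform estimates from compactness -/

/-- The quotients need not converge, but each is `o(1)`-close to the image under `L` of a unit
vector, and these images lie in the compact set `K`. -/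
theorem tendsto_smul_nhdsSet_of_isCompactOperator {B H : Type*} [NormedAddCommGroup B]
    [NormedSpace ℝ B] [NormedAddCommGroup H] [NormedSpace ℝ H] {S : Set H} {x : H} {d : H → B}
    {L : H →L[ℝ] B} (hd : HasFDerivWithinAt d L S x) (hx : d x = 0) {K : Set B} (hK : IsCompact K)
    (hLK : L '' Metric.closedBall 0 1 ⊆ K) :
    Tendsto (fun z => ‖z - x‖⁻¹ • d z) (𝓝[S] x ⊓ 𝓟 {x}ᶜ) (𝓝ˢ K) := by
  rw [(Metric.hasBasis_nhdsSet_thickening hK).tendsto_right_iff]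
  intro ε hε
  have h1 := (hasFDerivWithinAt_iff_isLittleO.1 hd).def (half_pos hε)
  rw [eventually_inf_principal]
  filter_upwards [h1] with z hz hzx
  have hz0 : 0 < ‖z - x‖ := norm_pos_iff.2 (sub_ne_zero.2 hzx)
  rw [Metric.mem_thickening_iff]
  refine ⟨L (‖z - x‖⁻¹ • (z - x)), hLK ⟨_, ?_, rfl⟩, ?_⟩
  · rw [mem_closedBall_zero_iff, norm_smul, norm_inv, norm_norm, inv_mul_cancel₀ hz0.ne']
  · rw [hx, sub_zero] at hz
    rw [dist_eq_norm, map_smul, ← smul_sub, norm_smul, norm_inv, norm_norm,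
      inv_mul_lt_iff₀ hz0]
    calc _ ≤ ε / 2 * ‖z - x‖ := hz
      _ < ‖z - x‖ * ε := by nlinarith

/-- If `D` is continuous and homogeneous in the second variable, and `d` vanishes at `x` with
compact derivative, then `D y' (d z) - D y (d z)` is small compared with `z - x`. -/
theorem eventually_norm_sub_le_of_isCompactOperator {A B H Z : Type*} [TopologicalSpace A]
    [NormedAddCommGroup B] [NormedSpace ℝ B] [NormedAddCommGroup H] [NormedSpace ℝ H]
    [NormedAddCommGroup Z] [NormedSpace ℝ Z] {V : Set A} {D : A → B → Z}
    (hD : ContinuousOn (fun p : A × B => D p.1 p.2) (V ×ˢ univ))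
    (hom : ∀ y ∈ V, ∀ (c : ℝ) b, D y (c • b) = c • D y b) {y : A} (hy : y ∈ V) {S : Set H} {x : H}
    {d : H → B} {L : H →L[ℝ] B} (hL : IsCompactOperator L) (hd : HasFDerivWithinAt d L S x)
    (hx : d x = 0) {ε : ℝ} (hε : 0 < ε) :
    ∀ᶠ p : A × H in 𝓝[V] y ×ˢ 𝓝[S] x, ‖D p.1 (d p.2) - D y (d p.2)‖ ≤ ε * ‖p.2 - x‖ := by
  have hK := hL.isCompact_closure_image_closedBall (1 : ℝ)
  set K := closure (L '' Metric.closedBall 0 1) with hKdef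
  have ht := tendsto_smul_nhdsSet_of_isCompactOperator hd hx hK subset_closure
  -- The tube lemma: continuity at each `(y, k)` with `k ∈ K` becomes one estimate near `{y} × K`.
  have h1 : {p : A × B | ‖D p.1 p.2 - D y p.2‖ < ε} ∈ 𝓝[V] y ×ˢ 𝓝ˢ K := by
    refine hK.mem_prod_nhdsSet_of_forall fun k _ => ?_
    have c1 : Tendsto (fun p : A × B => D p.1 p.2) (𝓝[V] y ×ˢ 𝓝 k) (𝓝 (D y k)) := by
      have := hD (y, k) ⟨hy, trivial⟩
      rwa [ContinuousWithinAt, nhdsWithin_prod_eq, nhdsWithin_univ] at this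
    have c2 : Tendsto (fun p : A × B => D y p.2) (𝓝[V] y ×ˢ 𝓝 k) (𝓝 (D y k)) := by
      have h3 : Tendsto (fun b : B => (y, b)) (𝓝 k) (𝓝[V] y ×ˢ 𝓝 k) :=
        (tendsto_const_nhdsWithin hy).prodMk tendsto_id
      exact (c1.comp h3).comp tendsto_snd
    have c3 := (c1.sub c2).norm
    rw [sub_self, norm_zero] at c3
    exact c3.eventually (gt_mem_nhds hε)
  -- Homogeneity permits dividing by `‖z - x‖`, so `x` itself is excluded here; at `x` both terms
  -- vanish because `D y 0 = 0`.
  have h2 : ∀ᶠ p : A × H in (𝓝[V] y ×ˢ 𝓝[S] x) ⊓ 𝓟 {p | p.2 ≠ x},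
      ‖D p.1 (‖p.2 - x‖⁻¹ • d p.2) - D y (‖p.2 - x‖⁻¹ • d p.2)‖ < ε := by
    have h3 : Tendsto (Prod.snd : A × H → H) ((𝓝[V] y ×ˢ 𝓝[S] x) ⊓ 𝓟 {p | p.2 ≠ x})
        (𝓝[S] x ⊓ 𝓟 {x}ᶜ) :=
      tendsto_inf.2 ⟨tendsto_snd.mono_left inf_le_left,
        tendsto_principal.2 (mem_inf_of_right (mem_principal_self _))⟩
    exact ((tendsto_fst.mono_left inf_le_left).prodMk (ht.comp h3)).eventually h1
  rw [eventually_inf_principal] at h2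
  have hV : ∀ᶠ p : A × H in 𝓝[V] y ×ˢ 𝓝[S] x, p.1 ∈ V :=
    tendsto_fst.eventually self_mem_nhdsWithin
  filter_upwards [h2, hV] with p hp hpV
  rcases eq_or_ne p.2 x with h | h
  · have e0 : ∀ y ∈ V, D y 0 = 0 := fun y hy => by
      simpa using hom y hy 0 0
    rw [h, hx, e0 _ hpV, e0 _ hy]
    simp
  · have hz0 : 0 < ‖p.2 - x‖ := norm_pos_iff.2 (sub_ne_zero.2 h)
    have := hp h
    rw [hom _ hpV, hom _ hy, ← smul_sub, norm_smul, norm_inv, norm_norm,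
      inv_mul_lt_iff₀ hz0] at this
    linarith

/-- Mean value inequality along a segment. -/
theorem norm_sub_sub_le_of_segment {A Z : Type*} [NormedAddCommGroup A] [NormedSpace ℝ A]
    [NormedAddCommGroup Z] [NormedSpace ℝ Z] {V : Set A} {g : A → Z} {g' : A → A →L[ℝ] Z}
    (hg : ∀ y ∈ V, HasFDerivWithinAt g (g' y) V y) {y y' : A} (hV : segment ℝ y y' ⊆ V) {c : ℝ}
    (hc : ∀ w ∈ segment ℝ y y', ‖g' w (y' - y) - g' y (y' - y)‖ ≤ c) :
    ‖g y' - g y - g' y (y' - y)‖ ≤ c := by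
  have hseg : ∀ t ∈ Icc (0 : ℝ) 1, AffineMap.lineMap y y' t ∈ segment ℝ y y' := fun t ht => by
    rw [segment_eq_image_lineMap]
    exact mem_image_of_mem _ ht
  -- Subtracting the linear curve `t ↦ t • g' y (y' - y)` leaves a curve whose derivative is exactly
  -- the difference bounded by `hc`.
  have h := norm_image_sub_le_of_norm_deriv_le_segment_01'
    (f := fun t : ℝ => g (AffineMap.lineMap y y' t) - t • g' y (y' - y))
    (f' := fun t => g' (AffineMap.lineMap y y' t) (y' - y) - g' y (y' - y)) (C := c)
    (fun t ht => ?_) (fun t ht => hc _ (hseg t (Ico_subset_Icc_self ht)))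
  · simpa [sub_right_comm] using h
  · refine HasDerivWithinAt.sub ?_ ?_
    · exact (hg _ (hV (hseg t ht))).comp_hasDerivWithinAt t
        (AffineMap.hasDerivWithinAt_lineMap) (fun s hs => hV (hseg s hs))
    · simpa using (hasDerivWithinAt_id t (Icc (0 : ℝ) 1)).smul_const (g' y (y' - y))

/-! ### The chain rule -/

theorem IsSc1.hasScDerivAt {U : Set (E.lvl 0)} {f : E.lvl 0 → F.lvl 0} (hf : IsSc1 U f)
    {x : E.lvl 1} (hx : x ∈ E.part U 1) : HasScDerivAt U f (scDeriv U f x) x :=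
  hasScDerivAt_scDeriv (hf.2.1 x hx)

theorem IsSc1.continuousOn_scDeriv {U : Set (E.lvl 0)} {f : E.lvl 0 → F.lvl 0} (hf : IsSc1 U f) :
    ContinuousOn (fun p : E.lvl 1 × E.lvl 0 => scDeriv U f p.1 p.2) (E.part U 1 ×ˢ univ) := by
  have h1 : ContinuousOn (scTangentMap U f) (tangentSet U) := hf.2.2.continuousOn
  have h2 := continuous_snd.comp_continuousOn h1
  refine h2.mono fun p hp => hp.1

/-- The remainder `g(f z) - g(f x) - Dg(y)(f z - f x)` is estimated along the segment from `y` to `f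
z` in `F_1`, where `g` is differentiable. The integrand-like term `Dg(w)(d z) - Dg(y)(d z)` is `o(‖z
- x‖)` because `d`, viewed from `E_1` to `F_0`, has a compact derivative. -/
theorem IsSc1.hasScDerivAt_comp {U : Set (E.lvl 0)} {V : Set (F.lvl 0)} {f : E.lvl 0 → F.lvl 0}
    {g : F.lvl 0 → G.lvl 0} (hg : IsSc1 V g) (hf : IsSc1 U f) (hV : IsScDomain V)
    (hm : MapsTo f U V) {x : E.lvl 1} (hx : x ∈ E.part U 1) :
    HasScDerivAt U (g ∘ f) ((scDeriv V g (levelMap f 1 x)).comp (scDeriv U f x)) x := by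
  set y := levelMap f 1 x with hy
  have hyV : y ∈ F.part V 1 := hf.1.mapsTo_levelMap hm 1 hx
  obtain ⟨δ, hδ, hseg⟩ := hV.shift.exists_ball_segment (x := y) hyV
  have hfx := hf.hasScDerivAt hx
  set d : E.lvl 1 → F.lvl 0 := fun z => f (E.toBase 1 z) - f (E.toBase 1 x) with hd
  have hd' : HasFDerivWithinAt d ((scDeriv U f x).comp (E.toBase 1)) (E.part U 1) x :=
    HasFDerivWithinAt.sub_const _ hfx
  have hcont : Tendsto (levelMap f 1) (𝓝[E.part U 1] x) (𝓝[F.part V 1] y) :=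
    tendsto_nhdsWithin_of_tendsto_nhds_of_eventually_within _ ((hf.1 1).2 x hx)
      (eventually_mem_nhdsWithin.mono fun z hz => hf.1.mapsTo_levelMap hm 1 hz)
  have e1 : HasFDerivWithinAt (fun z : E.lvl 1 => scDeriv V g y (d z))
      ((scDeriv V g y).comp ((scDeriv U f x).comp (E.toBase 1))) (E.part U 1) x :=
    (scDeriv V g y).hasFDerivAt.comp_hasFDerivWithinAt x hd'
  have e2 : HasFDerivWithinAt
      (fun z : E.lvl 1 => g (f (E.toBase 1 z)) - scDeriv V g y (d z)) (0 : E.lvl 1 →L[ℝ] G.lvl 0)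
      (E.part U 1) x := by
    rw [hasFDerivWithinAt_iff_isLittleO, Asymptotics.isLittleO_iff]
    intro ε hε
    have h1 := eventually_norm_sub_le_of_isCompactOperator hg.continuousOn_scDeriv
      (fun w _ c b => map_smul (scDeriv V g w) c b) hyV
      (E.isCompactOperator_toBase_one.clm_comp (scDeriv U f x)) hd' (sub_self _) hε
    -- The estimate holds for `w` and `z` independently, so it covers all points `w` of the segment
    -- belonging to a given `z`; the radius `min δ δ'` keeps that segment both in the domain and
    -- where the estimate applies.
    obtain ⟨pa, hpa, pb, hpb, h2⟩ := eventually_prod_iff.1 h1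
    obtain ⟨δ', hδ', hpa'⟩ := Metric.mem_nhdsWithin_iff.1 hpa
    have hev : ∀ᶠ z in 𝓝[E.part U 1] x, levelMap f 1 z ∈ Metric.ball y (min δ δ') :=
      hcont.eventually (mem_nhdsWithin_of_mem_nhds (Metric.ball_mem_nhds _ (lt_min hδ hδ')))
    filter_upwards [hpb, hev, self_mem_nhdsWithin] with z hz1 hz2 hz3
    have hzV : levelMap f 1 z ∈ F.part V 1 := hf.1.mapsTo_levelMap hm 1 hz3
    have hs := hseg _ ⟨hzV, Metric.ball_subset_ball (min_le_left _ _) hz2⟩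
    have hs' := (convex_ball y (min δ δ')).segment_subset
      (Metric.mem_ball_self (lt_min hδ hδ')) hz2
    have hdz : F.toBase 1 (levelMap f 1 z - y) = d z := by
      rw [map_sub, hy, hf.1.toBase_levelMap hz3, hf.1.toBase_levelMap hx]
    have key := norm_sub_sub_le_of_segment (V := F.part V 1)
      (g := fun w : F.lvl 1 => g (F.toBase 1 w)) (y := y) (y' := levelMap f 1 z)
      (c := ε * ‖z - x‖)
      (fun w hw => hg.hasScDerivAt hw) (fun w hw => (hs hw).1) (fun w hw => by
        have := h2 (hpa' ⟨Metric.ball_subset_ball (min_le_right _ _) (hs' hw), (hs hw).1⟩) hz1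
        simpa only [ContinuousLinearMap.comp_apply, hdz] using this)
    simp only [ContinuousLinearMap.comp_apply, hdz, hf.1.toBase_levelMap hz3] at key
    rw [hy, hf.1.toBase_levelMap hx] at key
    have hdx : d x = 0 := sub_self _
    simpa [hdx, sub_right_comm] using key
  have e3 := e2.add e1
  refine HasFDerivWithinAt.congr_fderiv (HasFDerivWithinAt.congr e3 (fun z _ => ?_) ?_) ?_
  · simp
  · simp
  · rw [zero_add]
    rfl

theorem IsSc1.scTangentMap_comp {U : Set (E.lvl 0)} {V : Set (F.lvl 0)} {f : E.lvl 0 → F.lvl 0}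
    {g : F.lvl 0 → G.lvl 0} (hg : IsSc1 V g) (hf : IsSc1 U f) (hU : IsScDomain U)
    (hV : IsScDomain V) (hm : MapsTo f U V) :
    EqOn (scTangentMap V g ∘ scTangentMap U f) (scTangentMap U (g ∘ f)) (tangentSet U) := by
  intro p hp
  refine Prod.ext ?_ ?_
  · exact (hf.1.levelMap_comp hp).symm
  · have := (hg.hasScDerivAt_comp hf hV hm hp).scDeriv_eq hU hp
    exact (DFunLike.congr_fun this p.2).symm

theorem IsSc0.mapsTo_scTangentMap {U : Set (E.lvl 0)} {V : Set (F.lvl 0)} {f : E.lvl 0 → F.lvl 0}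
    (hf : IsSc0 U f) (hm : MapsTo f U V) :
    MapsTo (scTangentMap U f) (tangentSet U) (tangentSet V) := fun _ hp =>
  hf.mapsTo_levelMap hm 1 hp

theorem IsSc1.comp {U : Set (E.lvl 0)} {V : Set (F.lvl 0)} {f : E.lvl 0 → F.lvl 0}
    {g : F.lvl 0 → G.lvl 0} (hg : IsSc1 V g) (hf : IsSc1 U f) (hU : IsScDomain U)
    (hV : IsScDomain V) (hm : MapsTo f U V) : IsSc1 U (g ∘ f) :=
  ⟨hg.1.comp hf.1 hm, fun _ hx => ⟨_, hg.hasScDerivAt_comp hf hV hm hx⟩,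
    (hg.2.2.comp hf.2.2 (hf.1.mapsTo_scTangentMap hm)).congr (hg.scTangentMap_comp hf hU hV hm)⟩

theorem IsSc.comp {k : ℕ} {E : ScBanach.{u}} {F : ScBanach.{v}} {G : ScBanach.{w}}
    {U : Set (E.lvl 0)} {V : Set (F.lvl 0)} {f : E.lvl 0 → F.lvl 0}
    {g : F.lvl 0 → G.lvl 0} (hg : IsSc k V g) (hf : IsSc k U f) (hU : IsScDomain U)
    (hV : IsScDomain V) (hm : MapsTo f U V) : IsSc k U (g ∘ f) := by
  induction k generalizing E F G with
  | zero => exact IsSc0.comp hg hf hm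
  | succ k ih =>
    exact ⟨hg.1.comp hf.1 hU hV hm,
      (ih hg.2 hf.2 hU.tangent hV.tangent (hf.1.1.mapsTo_scTangentMap hm)).congr
        (hg.1.scTangentMap_comp hf.1 hU hV hm)⟩

theorem IsScSmooth.comp {U : Set (E.lvl 0)} {V : Set (F.lvl 0)} {f : E.lvl 0 → F.lvl 0}
    {g : F.lvl 0 → G.lvl 0} (hg : IsScSmooth V g) (hf : IsScSmooth U f) (hU : IsScDomain U)
    (hV : IsScDomain V) (hm : MapsTo f U V) : IsScSmooth U (g ∘ f) := fun k =>
  (hg k).comp (hf k) hU hV hm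

/-! ### Sc-operators -/

/-- An sc-operator: a family of bounded operators on the levels, compatible with the
inclusions. -/
structure ScOperator (E : ScBanach.{u}) (F : ScBanach.{v}) where
  onLevel : ∀ m, E.lvl m →L[ℝ] F.lvl m
  comm : ∀ m x, onLevel m (E.incl m x) = F.incl m (onLevel (m + 1) x)

namespace ScOperator

/-- The identity of a Banach scale. -/
def id (E : ScBanach.{u}) : ScOperator E E := ⟨fun _ => ContinuousLinearMap.id ℝ _, fun _ _ => rfl⟩

/-- The projection `E ⊕ F → E`. -/
def fst (E : ScBanach.{u}) (F : ScBanach.{v}) : ScOperator (E.prod F) E :=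
  ⟨fun _ => ContinuousLinearMap.fst ℝ _ _, fun _ _ => rfl⟩

/-- The tangent of an sc-operator. -/
def tangent (A : ScOperator E F) : ScOperator E.tangent F.tangent :=
  ⟨fun m => (A.onLevel (m + 1)).prodMap (A.onLevel m),
    fun m x => Prod.ext (A.comm (m + 1) x.1) (A.comm m x.2)⟩

theorem toBase_onLevel (A : ScOperator E F) (m : ℕ) (x : E.lvl m) :
    F.toBase m (A.onLevel m x) = A.onLevel 0 (E.toBase m x) := by
  induction m with
  | zero => rfl
  | succ m ih => exact (congrArg (F.toBase m) (A.comm m x)).symm.trans (ih (E.incl m x))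

theorem isSc0 (A : ScOperator E F) (U : Set (E.lvl 0)) : IsSc0 U (A.onLevel 0) :=
  isSc0_of_levels (fun m => A.onLevel m) (fun m => (A.onLevel m).continuous.continuousOn)
    fun m x _ => A.toBase_onLevel m x

theorem hasScDerivAt (A : ScOperator E F) (U : Set (E.lvl 0)) (x : E.lvl 1) :
    HasScDerivAt U (A.onLevel 0) (A.onLevel 0) x :=
  ((A.onLevel 0).comp (E.toBase 1)).hasFDerivWithinAt

theorem scTangentMap_eqOn (A : ScOperator E F) {U : Set (E.lvl 0)} (hU : IsScDomain U) :
    EqOn (A.tangent.onLevel 0) (scTangentMap U (A.onLevel 0)) (tangentSet U) := fun p hp =>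
  Prod.ext (levelMap_eq (A.toBase_onLevel 1 p.1)).symm
    (DFunLike.congr_fun ((A.hasScDerivAt U p.1).scDeriv_eq hU hp) p.2).symm

/-- The tangent map of an sc-operator is again an sc-operator, so the induction on `k` reproduces
itself. -/
theorem isScSmooth (A : ScOperator E F) {U : Set (E.lvl 0)} (hU : IsScDomain U) :
    IsScSmooth U (A.onLevel 0) := by
  intro k
  induction k generalizing E F with
  | zero => exact A.isSc0 U
  | succ k ih =>
    exact ⟨⟨A.isSc0 U, fun x _ => ⟨_, A.hasScDerivAt U x⟩,
      (A.tangent.isSc0 _).congr (A.scTangentMap_eqOn hU)⟩,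
      (ih A.tangent hU.tangent).congr (A.scTangentMap_eqOn hU)⟩

end ScOperator

theorem isScSmooth_id {U : Set (E.lvl 0)} (hU : IsScDomain U) :
    IsScSmooth U (id : E.lvl 0 → E.lvl 0) :=
  (ScOperator.id E).isScSmooth hU

/-- `U` need not be open in `V`, so locality does not apply; restriction is treated as composition
with the identity. -/
theorem IsScSmooth.mono {U V : Set (E.lvl 0)} {f : E.lvl 0 → F.lvl 0} (hf : IsScSmooth V f)
    (hU : IsScDomain U) (hV : IsScDomain V) (h : U ⊆ V) : IsScSmooth U f :=
  hf.comp (isScSmooth_id hU) hU hV h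

theorem IsScSmooth.scTangentMap_comp {U : Set (E.lvl 0)} {V : Set (F.lvl 0)}
    {f : E.lvl 0 → F.lvl 0} {g : F.lvl 0 → G.lvl 0} (hg : IsScSmooth V g) (hf : IsScSmooth U f)
    (hU : IsScDomain U) (hV : IsScDomain V) (hm : MapsTo f U V) {p : E.tangent.lvl 0}
    (hp : p ∈ tangentSet U) :
    scTangentMap U (g ∘ f) p = scTangentMap V g (scTangentMap U f p) :=
  (hg.sc1.scTangentMap_comp hf.sc1 hU hV hm hp).symm

/-! ### Lifting the level of sc-smooth maps -/

/-- Suppose that a curve in a Banach space `B` is, after the injective operator `T`, differentiable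
with derivative `T ∘ g'`. Then the mean value inequality holds in `B`. -/
theorem norm_sub_sub_le_of_hasDerivWithinAt_comp {B Z : Type*} [NormedAddCommGroup B]
    [NormedSpace ℝ B] [CompleteSpace B] [NormedAddCommGroup Z] [NormedSpace ℝ Z] [CompleteSpace Z]
    {T : B →L[ℝ] Z} (hT : Function.Injective T) {g g' : ℝ → B}
    (hg' : ContinuousOn g' (Icc 0 1))
    (hg : ∀ t ∈ Icc (0 : ℝ) 1, HasDerivWithinAt (fun s => T (g s)) (T (g' t)) (Icc 0 1) t) {c : ℝ}
    (hc : ∀ t ∈ Icc (0 : ℝ) 1, ‖g' t - g' 0‖ ≤ c) : ‖g 1 - g 0 - g' 0‖ ≤ c := by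
  have hint : IntervalIntegrable g' MeasureTheory.volume 0 1 :=
    ContinuousOn.intervalIntegrable (by rwa [uIcc_of_le zero_le_one])
  have hint' : IntervalIntegrable (fun t => T (g' t)) MeasureTheory.volume 0 1 :=
    ContinuousOn.intervalIntegrable (by
      rw [uIcc_of_le zero_le_one]; exact T.continuous.comp_continuousOn hg')
  -- The fundamental theorem is available only in `Z`, where the curve is differentiable. Since `g'`
  -- is continuous in `B`, its integral exists in `B`, and injectivity of `T` transfers the identity
  -- there.
  have h1 : ∫ t in (0 : ℝ)..1, T (g' t) = T (g 1) - T (g 0) :=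
    intervalIntegral.integral_eq_sub_of_hasDeriv_right_of_le zero_le_one
      (fun t ht => (hg t ht).continuousWithinAt)
      (fun t ht => ((hg t (Ioo_subset_Icc_self ht)).mono_of_mem_nhdsWithin
        (mem_nhdsWithin_of_mem_nhds (Icc_mem_nhds ht.1 ht.2)))) hint'
  have h2 : ∫ t in (0 : ℝ)..1, g' t = g 1 - g 0 := by
    apply hT
    rw [map_sub, ← h1, T.intervalIntegral_comp_comm hint]
  have h3 : g 1 - g 0 - g' 0 = ∫ t in (0 : ℝ)..1, (g' t - g' 0) := by
    rw [intervalIntegral.integral_sub hint intervalIntegrable_const, h2]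
    simp
  rw [h3]
  have := intervalIntegral.norm_integral_le_of_norm_le_const (a := 0) (b := 1) (C := c)
    (f := fun t => g' t - g' 0) (fun t ht => hc t ?_)
  · simpa using this
  · rw [uIoc_of_le zero_le_one] at ht
    exact Ioc_subset_Icc_self ht

theorem IsSc1.toBase_levelMap_scTangentMap {U : Set (E.lvl 0)} {f : E.lvl 0 → F.lvl 0}
    (hf : IsSc1 U f) {x : E.lvl 2} (hx : x ∈ E.part U 2) (ξ : E.lvl 1) :
    F.toBase 1 ((levelMap (E := E.tangent) (F := F.tangent) (scTangentMap U f) 1 (x, ξ)).2) =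
      scDeriv U f (E.incl 1 x) (E.toBase 1 ξ) := by
  have h1 : ((x, ξ) : E.lvl 2 × E.lvl 1) ∈ E.tangent.part (tangentSet U) 1 := hx
  exact congrArg (fun q : F.lvl 1 × F.lvl 0 => q.2) (hf.2.2.toBase_levelMap (m := 1) h1)

/-- The operator `E_1 → F_1` to which the sc-derivative at a point on level `2` restricts. -/
noncomputable def IsSc1.scDerivOne {U : Set (E.lvl 0)} {f : E.lvl 0 → F.lvl 0}
    (hf : IsSc1 U f) {x : E.lvl 2} (hx : x ∈ E.part U 2) : E.lvl 1 →L[ℝ] F.lvl 1 where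
  toFun ξ := (levelMap (E := E.tangent) (F := F.tangent) (scTangentMap U f) 1 (x, ξ)).2
  map_add' ξ η := F.toBase_injective 1 (by
    simp only [map_add, hf.toBase_levelMap_scTangentMap hx])
  map_smul' c ξ := F.toBase_injective 1 (by
    simp only [map_smul, hf.toBase_levelMap_scTangentMap hx, RingHom.id_apply])
  cont := by
    have h1 : ContinuousOn (levelMap (E := E.tangent) (F := F.tangent) (scTangentMap U f) 1)
        (E.tangent.part (tangentSet U) 1) := (hf.2.2 1).2
    have h2 := continuous_snd.comp_continuousOn h1
    exact h2.comp_continuous (f := fun ξ : E.lvl 1 => ((x, ξ) : E.lvl 2 × E.lvl 1))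
      (Continuous.prodMk_right x) (fun ξ => hx)

/-- Along a segment in `E_2` the map `f` is differentiable only as an `F_0`-valued curve, but its
derivative is continuous in `F_1` because `Tf` is `sc⁰` on level `1`. Integration therefore gives
the mean value inequality in `F_1`, and the compact inclusion `E_2 → E_1` makes the remainder small.
-/
theorem IsSc1.hasScDerivAt_shift {U : Set (E.lvl 0)} {f : E.lvl 0 → F.lvl 0}
    (hf : IsSc1 U f) (hU : IsScDomain U) {x : E.lvl 2} (hx : x ∈ E.part U 2) :
    HasScDerivAt (E := E.shift) (F := F.shift) (E.part U 1) (levelMap f 1)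
      (hf.scDerivOne hx) x := by
  have hx' : x ∈ E.shift.part (E.part U 1) 1 := hx
  obtain ⟨δ, hδ, hseg⟩ := hU.shift.shift.exists_ball_segment (x := x) hx'
  set D : E.lvl 2 → E.lvl 1 → F.lvl 1 := fun z ξ =>
    (levelMap (E := E.tangent) (F := F.tangent) (scTangentMap U f) 1 (z, ξ)).2 with hD
  have hDb : ∀ {z : E.lvl 2}, z ∈ E.part U 2 → ∀ ξ, F.toBase 1 (D z ξ) =
      scDeriv U f (E.incl 1 z) (E.toBase 1 ξ) := fun hz ξ => hf.toBase_levelMap_scTangentMap hz ξ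
  have hDc : ContinuousOn (fun p : E.lvl 2 × E.lvl 1 => D p.1 p.2) (E.part U 2 ×ˢ univ) := by
    have h1 : ContinuousOn (levelMap (E := E.tangent) (F := F.tangent) (scTangentMap U f) 1)
        (E.tangent.part (tangentSet U) 1) := (hf.2.2 1).2
    rw [ScBanach.part_tangentSet] at h1
    exact continuous_snd.comp_continuousOn h1
  have hd : HasFDerivWithinAt (fun z : E.lvl 2 => E.incl 1 z - E.incl 1 x) (E.incl 1)
      (E.part U 2) x := (E.incl 1).hasFDerivWithinAt.sub_const _
  rw [HasScDerivAt, hasFDerivWithinAt_iff_isLittleO, Asymptotics.isLittleO_iff]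
  intro ε hε
  have h1 := eventually_norm_sub_le_of_isCompactOperator hDc
    (fun w hw c b => (hf.scDerivOne hw).map_smul c b) hx (E.incl_compact 1) hd (sub_self _) hε
  obtain ⟨pa, hpa, pb, hpb, h2⟩ := eventually_prod_iff.1 h1
  obtain ⟨δ', hδ', hpa'⟩ := Metric.mem_nhdsWithin_iff.1 hpa
  have hev : ∀ᶠ z in 𝓝[E.part U 2] x, z ∈ Metric.ball x (min δ δ') :=
    mem_nhdsWithin_of_mem_nhds (Metric.ball_mem_nhds _ (lt_min hδ hδ'))
  have goal : ∀ᶠ z in 𝓝[E.part U 2] x, ‖levelMap f 1 (E.incl 1 z) - levelMap f 1 (E.incl 1 x) -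
      D x (E.incl 1 (z - x))‖ ≤ ε * ‖z - x‖ := by
    filter_upwards [hpb, hev, self_mem_nhdsWithin] with z hz1 hz2 hz3
    have hs := hseg z ⟨hz3, Metric.ball_subset_ball (min_le_left _ _) hz2⟩
    have hs' := (convex_ball x (min δ δ')).segment_subset
      (Metric.mem_ball_self (lt_min hδ hδ')) hz2
    have hl : ∀ t ∈ Icc (0 : ℝ) 1, AffineMap.lineMap x z t ∈ segment ℝ x z := fun t ht => by
      rw [segment_eq_image_lineMap]
      exact mem_image_of_mem _ ht
    have hlU : ∀ t ∈ Icc (0 : ℝ) 1, AffineMap.lineMap x z t ∈ E.part U 2 := fun t ht =>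
      (hs (hl t ht)).1
    have key := norm_sub_sub_le_of_hasDerivWithinAt_comp (F.toBase_injective 1)
      (g := fun t => levelMap f 1 (E.incl 1 (AffineMap.lineMap x z t)))
      (g' := fun t => D (AffineMap.lineMap x z t) (E.incl 1 (z - x))) (c := ε * ‖z - x‖)
      (hDc.comp (f := fun t : ℝ => ((AffineMap.lineMap x z t : E.lvl 2), E.incl 1 (z - x)))
        (by fun_prop) fun t ht => ⟨hlU t ht, trivial⟩)
      (fun t ht => ?_) (fun t ht => ?_)
    · simpa using key
    · have e1 : HasDerivWithinAt (fun s : ℝ => E.incl 1 (AffineMap.lineMap x z s))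
          (E.incl 1 (z - x)) (Icc 0 1) t :=
        (E.incl 1).hasFDerivAt.comp_hasDerivWithinAt t AffineMap.hasDerivWithinAt_lineMap
      have e0 : HasFDerivWithinAt (fun z : E.lvl 1 => f (E.toBase 1 z))
          ((scDeriv U f (E.incl 1 (AffineMap.lineMap x z t))).comp (E.toBase 1)) (E.part U 1)
          (E.incl 1 (AffineMap.lineMap x z t)) := hf.hasScDerivAt (hlU t ht)
      have e2 := e0.comp_hasDerivWithinAt t e1 (fun s hs => hlU s hs)
      rw [hDb (hlU t ht)]
      refine HasDerivWithinAt.congr e2 (fun s hs => ?_) ?_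
      · exact hf.1.toBase_levelMap (hlU s hs)
      · exact hf.1.toBase_levelMap (hlU t ht)
    · have := h2 (hpa' ⟨Metric.ball_subset_ball (min_le_right _ _) (hs' (hl t ht)), hlU t ht⟩) hz1
      simpa [map_sub] using this
  exact goal

/-- Shifting commutes with `T`. This is what lets higher `scᵏ` regularity pass to the shift by
induction. -/
theorem IsSc1.scTangentMap_shift {U : Set (E.lvl 0)} {f : E.lvl 0 → F.lvl 0}
    (hf : IsSc1 U f) (hU : IsScDomain U) :
    EqOn (levelMap (E := E.tangent) (F := F.tangent) (scTangentMap U f) 1)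
      (scTangentMap (E := E.shift) (F := F.shift) (E.part U 1) (levelMap f 1))
      (tangentSet (E := E.shift) (E.part U 1)) := by
  intro p hp
  have hp' : p.1 ∈ E.part U 2 := hp
  refine Prod.ext ?_ ?_
  · apply F.toBase_injective 2
    have h1 : F.incl 1 (levelMap (E := E.tangent) (F := F.tangent) (scTangentMap U f) 1 p).1 =
        levelMap f 1 (E.incl 1 p.1) :=
      congrArg (fun q : F.lvl 1 × F.lvl 0 => q.1) (hf.2.2.toBase_levelMap (m := 1) (x := p) hp)
    have h2 : F.toBase 2 (levelMap (E := E.shift) (F := F.shift) (levelMap f 1) 1 p.1) =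
        f (E.toBase 2 p.1) :=
      (congrArg (F.toBase 2) (levelMap_shift hf.1 hp')).trans (hf.1.toBase_levelMap hp')
    have h3 : F.toBase 1 (levelMap f 1 (E.incl 1 p.1)) = f (E.toBase 2 p.1) :=
      hf.1.toBase_levelMap hp'
    exact ((congrArg (F.toBase 1) h1).trans h3).trans h2.symm
  · have := (hf.hasScDerivAt_shift hU hp').scDeriv_eq hU.shift hp
    exact (DFunLike.congr_fun this p.2).symm

theorem IsSc1.shift {U : Set (E.lvl 0)} {f : E.lvl 0 → F.lvl 0} (hf : IsSc1 U f)
    (hU : IsScDomain U) : IsSc1 (E := E.shift) (F := F.shift) (E.part U 1) (levelMap f 1) :=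
  ⟨hf.1.shift, fun _ hx => ⟨_, hf.hasScDerivAt_shift hU hx⟩,
    (IsSc0.congr (E := E.shift.tangent) (F := F.shift.tangent) hf.2.2.shift
      (hf.scTangentMap_shift hU))⟩

theorem IsSc.shift {k : ℕ} {E : ScBanach.{u}} {F : ScBanach.{v}} {U : Set (E.lvl 0)}
    {f : E.lvl 0 → F.lvl 0} (hf : IsSc k U f) (hU : IsScDomain U) :
    IsSc k (E := E.shift) (F := F.shift) (E.part U 1) (levelMap f 1) := by
  induction k generalizing E F with
  | zero => exact IsSc0.shift hf
  | succ k ih =>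
    exact ⟨hf.1.shift hU, IsSc.congr (E := E.shift.tangent) (F := F.shift.tangent)
      (ih hf.2 hU.tangent) (hf.1.scTangentMap_shift hU)⟩

theorem IsScSmooth.shift {U : Set (E.lvl 0)} {f : E.lvl 0 → F.lvl 0} (hf : IsScSmooth U f)
    (hU : IsScDomain U) :
    IsScSmooth (E := E.shift) (F := F.shift) (E.part U 1) (levelMap f 1) := fun k =>
  (hf k).shift hU

/-! ### Sc-retracts -/

section Retracts

variable {C O U : Set (E.lvl 0)} {r : E.lvl 0 → E.lvl 0} {f : E.lvl 0 → F.lvl 0}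

namespace IsRetractionOnto

theorem mapsTo (h : IsRetractionOnto C O U r) : MapsTo r U U := h.2.1

theorem smooth (h : IsRetractionOnto C O U r) : IsScSmooth U r := h.2.2.2.1

theorem mapsTo_image (h : IsRetractionOnto C O U r) : MapsTo r U O := fun _ hx =>
  h.2.2.2.2 ▸ mem_image_of_mem r hx

theorem subset (h : IsRetractionOnto C O U r) : O ⊆ U := by
  rw [← h.2.2.2.2]
  exact h.mapsTo.image_subset

theorem eq_self (h : IsRetractionOnto C O U r) {x : E.lvl 0} (hx : x ∈ O) : r x = x := by
  rw [← h.2.2.2.2] at hx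
  obtain ⟨y, hy, rfl⟩ := hx
  exact h.2.2.1 y hy

theorem isScDomain (h : IsRetractionOnto C O U r) (hC : IsPartialQuadrant E C) : IsScDomain U :=
  ⟨C, hC, h.1⟩

theorem scTangentMap_mem (h : IsRetractionOnto C O U r) {p : E.tangent.lvl 0}
    (hp : p ∈ tangentSet U) : scTangentMap U r p ∈ tangentSet O :=
  h.smooth.sc0.mapsTo_scTangentMap h.mapsTo_image hp

/-- Two retractions onto `O` satisfy `r ∘ r' = r'`, hence `Tr ∘ Tr' = Tr'`, so every fixed point of
`Tr'` is fixed by `Tr`. -/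
theorem scTangentMap_eq_of_mem (hC : IsPartialQuadrant E C) (h : IsRetractionOnto C O U r)
    {p : E.tangent.lvl 0} (hp : p ∈ tangentRetract C O) :
    p ∈ tangentSet U ∧ scTangentMap U r p = p := by
  obtain ⟨U', r', h', hpU, hpr⟩ := hp
  have h1 : p ∈ tangentSet O := hpr ▸ h'.scTangentMap_mem hpU
  have h2 : EqOn (r ∘ r') r' U' := fun x hx => h.eq_self (h'.mapsTo_image hx)
  have h3 := h.smooth.scTangentMap_comp h'.smooth (h'.isScDomain hC) (h.isScDomain hC)
    (fun x hx => h.subset (h'.mapsTo_image hx)) hpU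
  rw [scTangentMap_congr h2 hpU, hpr] at h3
  exact ⟨h.subset h1, h3.symm⟩

theorem mem_tangentRetract (hC : IsPartialQuadrant E C) (h : IsRetractionOnto C O U r)
    {p : E.tangent.lvl 0} :
    p ∈ tangentRetract C O ↔ p ∈ tangentSet U ∧ scTangentMap U r p = p :=
  ⟨fun hp => h.scTangentMap_eq_of_mem hC hp, fun hp => ⟨U, r, h, hp⟩⟩

theorem tangent (hC : IsPartialQuadrant E C) (h : IsRetractionOnto C O U r) :
    IsRetractionOnto (tangentSet C) (tangentRetract C O) (tangentSet U) (scTangentMap U r) := by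
  have idem : ∀ p ∈ tangentSet U, scTangentMap U r (scTangentMap U r p) = scTangentMap U r p := by
    intro p hp
    rw [← h.smooth.scTangentMap_comp h.smooth (h.isScDomain hC) (h.isScDomain hC) h.mapsTo hp]
    exact scTangentMap_congr (fun x hx => h.2.2.1 x hx) hp
  have hmaps : MapsTo (scTangentMap U r) (tangentSet U) (tangentSet U) :=
    h.smooth.sc0.mapsTo_scTangentMap h.mapsTo
  refine ⟨h.1.tangent, hmaps, idem, h.smooth.tangent, ?_⟩
  ext p
  rw [h.mem_tangentRetract hC]
  refine ⟨?_, fun hp => ⟨p, hp⟩⟩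
  rintro ⟨q, hq, rfl⟩
  exact ⟨hmaps hq, idem q hq⟩

theorem shift (hC : IsPartialQuadrant E C) (h : IsRetractionOnto C O U r) :
    IsRetractionOnto (E := E.shift) (E.part C 1) (E.part O 1) (E.part U 1) (levelMap r 1) := by
  have h0 := h.smooth.sc0
  refine ⟨h.1.shift, h0.mapsTo_levelMap h.mapsTo 1, fun x hx => ?_,
    h.smooth.shift (h.isScDomain hC), ?_⟩
  · apply levelMap_eq
    rw [h0.toBase_levelMap hx, h.2.2.1 _ hx]
  · ext x
    constructor
    · rintro ⟨y, hy, rfl⟩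
      exact h0.mapsTo_levelMap h.mapsTo_image 1 hy
    · intro hx
      exact ⟨x, h.subset hx, levelMap_eq (h.eq_self hx).symm⟩

/-- The retraction is restricted to the part of `U` that it maps into `W`, not to `U ∩ W`, which `r`
need not preserve. -/
theorem inter_open (h : IsRetractionOnto C O U r) (hC : IsPartialQuadrant E C)
    {W : Set (E.lvl 0)} (hW : IsOpen W) : ∃ W', IsOpen W' ∧ (∀ x ∈ U, x ∈ W' ↔ r x ∈ W) ∧
      IsRetractionOnto C (O ∩ W) (U ∩ W') r := by
  obtain ⟨W', hW', hWW⟩ := continuousOn_iff'.1 h.smooth.sc0.continuousOn W hW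
  have hiff : ∀ x ∈ U, x ∈ W' ↔ r x ∈ W := fun x hx =>
    ⟨fun hx' => (hWW.symm.subset ⟨hx', hx⟩).1, fun hx' => (hWW.subset ⟨hx', hx⟩).1⟩
  refine ⟨W', hW', hiff, h.1.inter_open hW', fun x hx => ⟨h.mapsTo hx.1, ?_⟩,
    fun x hx => h.2.2.1 x hx.1, ?_, ?_⟩
  · rw [hiff _ (h.mapsTo hx.1), h.2.2.1 x hx.1, ← hiff x hx.1]
    exact hx.2
  · exact h.smooth.mono ((h.isScDomain hC).inter_open hW') (h.isScDomain hC) inter_subset_left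
  · ext x
    constructor
    · rintro ⟨y, hy, rfl⟩
      exact ⟨h.mapsTo_image hy.1, (hiff y hy.1).1 hy.2⟩
    · intro hx
      refine ⟨x, ⟨h.subset hx.1, (hiff x (h.subset hx.1)).2 ?_⟩, h.eq_self hx.1⟩
      rw [h.eq_self hx.1]
      exact hx.2

end IsRetractionOnto

theorem IsScRetract.shift (h : IsScRetract E C O) :
    IsScRetract E.shift (E.part C 1) (E.part O 1) := by
  obtain ⟨hC, U, r, hr⟩ := h
  exact ⟨hC.shift, _, _, hr.shift hC⟩

theorem IsScRetract.tangent (h : IsScRetract E C O) :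
    IsScRetract E.tangent (tangentSet C) (tangentRetract C O) := by
  obtain ⟨hC, U, r, hr⟩ := h
  exact ⟨hC.tangent, _, _, hr.tangent hC⟩

theorem IsScRetract.inter_open (h : IsScRetract E C O) {W : Set (E.lvl 0)} (hW : IsOpen W) :
    IsScRetract E C (O ∩ W) := by
  obtain ⟨hC, U, r, hr⟩ := h
  obtain ⟨W', _, _, h'⟩ := hr.inter_open hC hW
  exact ⟨hC, _, _, h'⟩

theorem tangentRetract_subset : tangentRetract C O ⊆ tangentSet O := by
  rintro p ⟨U, r, h, hp, hpr⟩
  exact hpr ▸ h.scTangentMap_mem hp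

/-- The restricted retraction has the same derivatives, and a fixed point of `Tr` has its base point
in `O`, where membership in `W'` and in `W` coincide. -/
theorem tangentRetract_inter_open (hO : IsScRetract E C O) {W : Set (E.lvl 0)} (hW : IsOpen W) :
    tangentRetract C (O ∩ W) = tangentRetract C O ∩ tangentSet W := by
  obtain ⟨hC, U, r, hr⟩ := hO
  obtain ⟨W', hW', hiff, h'⟩ := hr.inter_open hC hW
  ext p
  rw [h'.mem_tangentRetract hC, mem_inter_iff, hr.mem_tangentRetract hC]
  constructor
  · rintro ⟨hp, hpr⟩
    have h1 := h'.scTangentMap_mem hp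
    rw [hpr] at h1
    rw [scTangentMap_inter_open hW' hp] at hpr
    exact ⟨⟨hp.1, hpr⟩, h1.2⟩
  · rintro ⟨⟨hp, hpr⟩, hpW⟩
    have h1 := hr.scTangentMap_mem hp
    rw [hpr] at h1
    have h2 : p ∈ tangentSet (U ∩ W') := by
      refine ⟨hp, (hiff _ hp).2 ?_⟩
      rw [hr.eq_self h1]
      exact hpW
    exact ⟨h2, (scTangentMap_inter_open hW' h2).trans hpr⟩

/-! ### Sc-smooth maps on sc-retracts -/

namespace IsScSmoothOnRetract

theorem isScRetract (hf : IsScSmoothOnRetract C O f) : IsScRetract E C O :=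
  ⟨hf.1, hf.2.choose, hf.2.choose_spec.choose, hf.2.choose_spec.choose_spec.1⟩

/-- Independence of the retraction: `f ∘ r = (f ∘ r') ∘ r`, because `r'` is the identity on `O`. -/
theorem comp_retraction (hf : IsScSmoothOnRetract C O f) (hr : IsRetractionOnto C O U r) :
    IsScSmooth U (f ∘ r) := by
  obtain ⟨hC, U', r', h', hs⟩ := hf
  refine (hs.comp hr.smooth (hr.isScDomain hC) (h'.isScDomain hC)
    (fun x hx => h'.subset (hr.mapsTo_image hx))).congr fun x hx => ?_
  simp only [Function.comp]
  rw [h'.eq_self (hr.mapsTo_image hx)]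

theorem congr (hf : IsScSmoothOnRetract C O f) {g : E.lvl 0 → F.lvl 0} (h : EqOn f g O) :
    IsScSmoothOnRetract C O g := by
  obtain ⟨hC, U, r, hr, hs⟩ := hf
  exact ⟨hC, U, r, hr, hs.congr fun x hx => h (hr.mapsTo_image hx)⟩

theorem continuousOn (hf : IsScSmoothOnRetract C O f) : ContinuousOn f O := by
  obtain ⟨hC, U, r, hr, hs⟩ := hf
  refine (hs.sc0.continuousOn.mono hr.subset).congr fun x hx => ?_
  rw [Function.comp, hr.eq_self hx]

theorem mem_range_toBase (hf : IsScSmoothOnRetract C O f) {m : ℕ} {x : E.lvl m}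
    (hx : E.toBase m x ∈ O) : f (E.toBase m x) ∈ range (F.toBase m) := by
  obtain ⟨hC, U, r, hr, hs⟩ := hf
  have := (hs.sc0 m).1 x (hr.subset hx)
  rwa [Function.comp, hr.eq_self hx] at this

theorem inter_open (hf : IsScSmoothOnRetract C O f) {W : Set (E.lvl 0)} (hW : IsOpen W) :
    IsScSmoothOnRetract C (O ∩ W) f := by
  obtain ⟨hC, U, r, hr, hs⟩ := hf
  obtain ⟨W', hW', _, h'⟩ := hr.inter_open hC hW
  exact ⟨hC, _, r, h', hs.mono (h'.isScDomain hC) (hr.isScDomain hC) inter_subset_left⟩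

theorem comp {C' O' : Set (F.lvl 0)} {g : F.lvl 0 → G.lvl 0} (hg : IsScSmoothOnRetract C' O' g)
    (hf : IsScSmoothOnRetract C O f) (hm : MapsTo f O O') :
    IsScSmoothOnRetract C O (g ∘ f) := by
  obtain ⟨hC, U, r, hr, hs⟩ := hf
  obtain ⟨hC', U', r', hr', hs'⟩ := hg
  have hm' : MapsTo (f ∘ r) U O' := fun x hx => hm (hr.mapsTo_image hx)
  refine ⟨hC, U, r, hr, (hs'.comp hs (hr.isScDomain hC) (hr'.isScDomain hC')
    (hm'.mono_right hr'.subset)).congr fun x hx => congrArg g (hr'.eq_self (hm' hx))⟩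

/-- Open sets of `O` pull back under `r` to relatively open sets of `U`, which reduces the claim to
locality of sc-smoothness for `f ∘ r`. -/
theorem of_local (hO : IsScRetract E C O)
    (h : ∀ x ∈ O, ∃ W, IsOpen W ∧ x ∈ W ∧ IsScSmoothOnRetract C (O ∩ W) f) :
    IsScSmoothOnRetract C O f := by
  obtain ⟨hC, U, r, hr⟩ := hO
  refine ⟨hC, U, r, hr, isScSmooth_of_local fun y hy => ?_⟩
  obtain ⟨W, hW, hyW, hf⟩ := h _ (hr.mapsTo_image hy)
  obtain ⟨W', hW', hiff, h'⟩ := hr.inter_open hC hW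
  exact ⟨W', hW', (hiff y hy).2 hyW, hf.comp_retraction h'⟩

theorem shift (hf : IsScSmoothOnRetract C O f) :
    IsScSmoothOnRetract (E := E.shift) (F := F.shift) (E.part C 1) (E.part O 1)
      (levelMap f 1) := by
  obtain ⟨hC, U, r, hr, hs⟩ := hf
  refine ⟨hC.shift, _, _, hr.shift hC, IsScSmooth.congr (E := E.shift) (F := F.shift)
    (hs.shift (hr.isScDomain hC)) fun x hx => ?_⟩
  exact hr.smooth.sc0.levelMap_comp hx

end IsScSmoothOnRetract

theorem ScOperator.isScSmoothOnRetract (A : ScOperator E F) (hO : IsScRetract E C O) :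
    IsScSmoothOnRetract C O (A.onLevel 0) := by
  obtain ⟨hC, U, r, hr⟩ := hO
  have hU := hr.isScDomain hC
  exact ⟨hC, U, r, hr, (A.isScSmooth hU).comp hr.smooth hU hU hr.mapsTo⟩

theorem isScSmoothOnRetract_id (hO : IsScRetract E C O) :
    IsScSmoothOnRetract C O (id : E.lvl 0 → E.lvl 0) :=
  (ScOperator.id E).isScSmoothOnRetract hO

/-! ### Derivatives of sc-smooth maps on sc-retracts -/

/-- From `(f ∘ r) ∘ r' = f ∘ r'` and `Tr' p = p`. -/
theorem IsScSmoothOnRetract.scTangentMap_eq (hf : IsScSmoothOnRetract C O f)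
    (hr : IsRetractionOnto C O U r) {U' : Set (E.lvl 0)} {r' : E.lvl 0 → E.lvl 0}
    (hr' : IsRetractionOnto C O U' r') {p : E.tangent.lvl 0} (hp : p ∈ tangentRetract C O) :
    scTangentMap U (f ∘ r) p = scTangentMap U' (f ∘ r') p := by
  obtain ⟨hpU, hpr⟩ := hr.scTangentMap_eq_of_mem hf.1 hp
  obtain ⟨hpU', hpr'⟩ := hr'.scTangentMap_eq_of_mem hf.1 hp
  have h1 := (hf.comp_retraction hr).scTangentMap_comp hr'.smooth (hr'.isScDomain hf.1)
    (hr.isScDomain hf.1) (fun x hx => hr.subset (hr'.mapsTo_image hx)) hpU'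
  rw [hpr'] at h1
  rw [← h1]
  refine scTangentMap_congr (fun x hx => ?_) hpU'
  simp only [Function.comp]
  rw [hr.eq_self (hr'.mapsTo_image hx)]

variable {x : E.lvl 1} {ξ : E.lvl 0} {η : F.lvl 0}

theorem HasRetractDeriv.mem (h : HasRetractDeriv C O f x ξ η) : (x, ξ) ∈ tangentRetract C O :=
  h.choose_spec.choose_spec.2.2.1

theorem HasRetractDeriv.toBase_mem (h : HasRetractDeriv C O f x ξ η) : E.toBase 1 x ∈ O :=
  tangentRetract_subset h.mem

theorem HasRetractDeriv.isScSmoothOnRetract (h : HasRetractDeriv C O f x ξ η)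
    (hC : IsPartialQuadrant E C) : IsScSmoothOnRetract C O f := by
  obtain ⟨U, r, hr, hs, _⟩ := h
  exact ⟨hC, U, r, hr, hs⟩

theorem IsScSmoothOnRetract.hasRetractDeriv_iff (hf : IsScSmoothOnRetract C O f)
    (hr : IsRetractionOnto C O U r) : HasRetractDeriv C O f x ξ η ↔
      (x, ξ) ∈ tangentRetract C O ∧ scDeriv U (f ∘ r) x ξ = η := by
  constructor
  · rintro ⟨U', r', hr', hs', hp, rfl⟩
    exact ⟨hp, congrArg (fun q : F.lvl 1 × F.lvl 0 => q.2) (hf.scTangentMap_eq hr hr' hp)⟩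
  · rintro ⟨hp, rfl⟩
    exact ⟨U, r, hr, hf.comp_retraction hr, hp, rfl⟩

/-- The chain rule is a statement about full tangent maps; since the base component is known in
advance, nothing is lost by including it. -/
theorem IsScSmoothOnRetract.hasRetractDeriv_iff_scTangentMap (hf : IsScSmoothOnRetract C O f)
    (hr : IsRetractionOnto C O U r) {y : F.lvl 1} (hy : F.toBase 1 y = f (E.toBase 1 x)) :
    HasRetractDeriv C O f x ξ η ↔
      (x, ξ) ∈ tangentRetract C O ∧ scTangentMap U (f ∘ r) (x, ξ) = (y, η) := by
  rw [hf.hasRetractDeriv_iff hr]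
  refine and_congr_right fun hp => ?_
  have h1 : levelMap (f ∘ r) 1 x = y := levelMap_eq (by
    rw [hy, Function.comp, hr.eq_self (tangentRetract_subset hp)])
  rw [scTangentMap, Prod.mk.injEq]
  simp only [h1, true_and]

theorem HasRetractDeriv.unique {η' : F.lvl 0} (hC : IsPartialQuadrant E C)
    (h : HasRetractDeriv C O f x ξ η) (h' : HasRetractDeriv C O f x ξ η') : η = η' := by
  have hf := h.isScSmoothOnRetract hC
  obtain ⟨_, U, r, hr, _⟩ := id hf
  rw [hf.hasRetractDeriv_iff hr] at h h'
  exact h.2.symm.trans h'.2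

theorem IsScSmoothOnRetract.exists_hasRetractDeriv (hf : IsScSmoothOnRetract C O f)
    (h : (x, ξ) ∈ tangentRetract C O) : ∃ η, HasRetractDeriv C O f x ξ η := by
  obtain ⟨hC, U, r, hr, hs⟩ := hf
  exact ⟨_, U, r, hr, hs, h, rfl⟩

theorem HasRetractDeriv.congr {g : E.lvl 0 → F.lvl 0} (h : HasRetractDeriv C O f x ξ η)
    (hfg : EqOn f g O) : HasRetractDeriv C O g x ξ η := by
  have hx := h.toBase_mem
  obtain ⟨U, r, hr, hs, hp, rfl⟩ := h
  have he : EqOn (f ∘ r) (g ∘ r) U := fun x hx => hfg (hr.mapsTo_image hx)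
  exact ⟨U, r, hr, hs.congr he, hp, by rw [scDeriv_congr he (hr.subset hx)]⟩

theorem hasRetractDeriv_id (hC : IsPartialQuadrant E C) (h : (x, ξ) ∈ tangentRetract C O) :
    HasRetractDeriv C O (id : E.lvl 0 → E.lvl 0) x ξ ξ := by
  have h' := h
  obtain ⟨U, r, hr, hp⟩ := h'
  exact ((isScSmoothOnRetract_id ⟨hC, U, r, hr⟩).hasRetractDeriv_iff_scTangentMap hr
    (y := x) rfl).2 ⟨h, hp.2⟩

variable {C' O' : Set (F.lvl 0)} {y : F.lvl 1}

/-- On `U` one has `g ∘ f ∘ r = (g ∘ r') ∘ (f ∘ r)`, to which the chain rule for relatively open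
domains applies. -/
theorem HasRetractDeriv.comp {g : F.lvl 0 → G.lvl 0} {ζ : G.lvl 0}
    (h' : HasRetractDeriv C' O' g y η ζ) (h : HasRetractDeriv C O f x ξ η)
    (hC : IsPartialQuadrant E C) (hC' : IsPartialQuadrant F C')
    (hy : F.toBase 1 y = f (E.toBase 1 x)) (hm : MapsTo f O O') :
    HasRetractDeriv C O (g ∘ f) x ξ ζ := by
  have hf := h.isScSmoothOnRetract hC
  have hg := h'.isScSmoothOnRetract hC'
  have hgf := hg.comp hf hm
  obtain ⟨z, hz⟩ := hg.mem_range_toBase h'.toBase_mem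
  obtain ⟨_, U, r, hr, hs⟩ := id hf
  obtain ⟨_, U', r', hr', hs'⟩ := id hg
  rw [hf.hasRetractDeriv_iff_scTangentMap hr hy] at h
  rw [hg.hasRetractDeriv_iff_scTangentMap hr' hz] at h'
  rw [hgf.hasRetractDeriv_iff_scTangentMap hr (hz.trans (congrArg g hy))]
  refine ⟨h.1, ?_⟩
  have hpU := (hr.scTangentMap_eq_of_mem hC h.1).1
  have hm' : MapsTo (f ∘ r) U O' := fun x hx => hm (hr.mapsTo_image hx)
  have h1 := hs'.scTangentMap_comp hs (hr.isScDomain hC) (hr'.isScDomain hC')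
    (hm'.mono_right hr'.subset) hpU
  rw [h.2, h'.2] at h1
  rw [← h1]
  exact scTangentMap_congr (fun x hx => congrArg g (hr'.eq_self (hm' hx)).symm) hpU

/-- Since `r' ∘ f ∘ r = f ∘ r`, every value of `T(f ∘ r)` is fixed by `Tr'`. -/
theorem HasRetractDeriv.mem_tangentRetract (h : HasRetractDeriv C O f x ξ η)
    (hC : IsPartialQuadrant E C) (hO' : IsScRetract F C' O')
    (hy : F.toBase 1 y = f (E.toBase 1 x)) (hm : MapsTo f O O') :
    (y, η) ∈ tangentRetract C' O' := by
  have hf := h.isScSmoothOnRetract hC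
  obtain ⟨_, U, r, hr, hs⟩ := id hf
  obtain ⟨hC', U', r', hr'⟩ := hO'
  rw [hf.hasRetractDeriv_iff_scTangentMap hr hy] at h
  have hpU := (hr.scTangentMap_eq_of_mem hC h.1).1
  have hm' : MapsTo (f ∘ r) U O' := fun x hx => hm (hr.mapsTo_image hx)
  have h1 := hr'.smooth.scTangentMap_comp hs (hr.isScDomain hC) (hr'.isScDomain hC')
    (hm'.mono_right hr'.subset) hpU
  have h2 : EqOn (r' ∘ f ∘ r) (f ∘ r) U := fun x hx => hr'.eq_self (hm' hx)
  rw [scTangentMap_congr h2 hpU, h.2] at h1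
  rw [hr'.mem_tangentRetract hC']
  refine ⟨?_, h1.symm⟩
  rw [← h.2]
  exact hs.sc0.mapsTo_scTangentMap (hm'.mono_right hr'.subset) hpU

theorem HasRetractDeriv.inter_open (h : HasRetractDeriv C O f x ξ η)
    (hC : IsPartialQuadrant E C) {W : Set (E.lvl 0)} (hW : IsOpen W) (hx : E.toBase 1 x ∈ W) :
    HasRetractDeriv C (O ∩ W) f x ξ η := by
  have hf := h.isScSmoothOnRetract hC
  have hp : (x, ξ) ∈ tangentRetract C (O ∩ W) := by
    rw [tangentRetract_inter_open hf.isScRetract hW]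
    exact ⟨h.mem, hx⟩
  obtain ⟨_, U, r, hr, hs⟩ := id hf
  obtain ⟨W', hW', hiff, hr'⟩ := hr.inter_open hC hW
  rw [hf.hasRetractDeriv_iff hr] at h
  rw [(hf.inter_open hW).hasRetractDeriv_iff hr']
  refine ⟨hp, Eq.trans ?_ h.2⟩
  exact congrArg (fun q : F.lvl 1 × F.lvl 0 => q.2)
    (scTangentMap_inter_open (f := f ∘ r) hW' (hr'.scTangentMap_eq_of_mem hC hp).1)

/-- A derivative on all of `O` exists by sc-smoothness there; restricted to `O ∩ W` it must be the
given one by uniqueness. -/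
theorem HasRetractDeriv.of_inter_open (hf : IsScSmoothOnRetract C O f)
    {W : Set (E.lvl 0)} (hW : IsOpen W) (h : HasRetractDeriv C (O ∩ W) f x ξ η) :
    HasRetractDeriv C O f x ξ η := by
  have hp := h.mem
  rw [tangentRetract_inter_open hf.isScRetract hW] at hp
  obtain ⟨η', h'⟩ := hf.exists_hasRetractDeriv hp.1
  rwa [h.unique hf.1 (h'.inter_open hf.1 hW hp.2)]

/-- The tangent map of an sc-smooth map on an sc-retract is sc-smooth. -/
theorem IsScSmoothOnRetract.tangent (hf : IsScSmoothOnRetract C O f)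
    {g : E.tangent.lvl 0 → F.tangent.lvl 0}
    (hg : ∀ p ∈ tangentRetract C O, F.toBase 1 (g p).1 = f (E.toBase 1 p.1) ∧
      HasRetractDeriv C O f p.1 p.2 (g p).2) :
    IsScSmoothOnRetract (tangentSet C) (tangentRetract C O) g := by
  obtain ⟨hC, U, r, hr, hs⟩ := id hf
  refine ⟨hC.tangent, _, _, hr.tangent hC, hs.tangent.congr fun p hp => ?_⟩
  have h1 : scTangentMap U r p ∈ tangentRetract C O := (hr.tangent hC).mapsTo_image hp
  obtain ⟨h2, h3⟩ := hg _ h1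
  have h4 := ((hf.hasRetractDeriv_iff_scTangentMap hr h2).1 h3).2
  have h5 := hs.scTangentMap_comp hr.smooth (hr.isScDomain hC) (hr.isScDomain hC) hr.mapsTo hp
  -- `f ∘ r` absorbs a further `r`, so `T(f ∘ r) ∘ Tr = T(f ∘ r)`: the decompression of `g` by `Tr`
  -- is `T(f ∘ r)`.
  have h6 : EqOn ((f ∘ r) ∘ r) (f ∘ r) U := fun x hx => congrArg f (hr.2.2.1 x hx)
  rw [scTangentMap_congr h6 hp] at h5
  exact h5.trans h4

end Retracts

/-! ### Paracompactness -/

/-- If `q : Y → X` is continuous, `X` is a paracompact Hausdorff space, and every point of `X` has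
an open neighbourhood with paracompact preimage, then `Y` is paracompact. -/
theorem paracompactSpace_of_continuous {X : Type v} {Y : Type w} [TopologicalSpace X]
    [TopologicalSpace Y] [ParacompactSpace X] [T2Space X] {q : Y → X} (hq : Continuous q)
    (h : ∀ x, ∃ V, IsOpen V ∧ x ∈ V ∧ ParacompactSpace (q ⁻¹' V)) : ParacompactSpace Y := by
  choose V hVo hxV hP using h
  obtain ⟨V', hV'o, hV'c, hV'lf, hV'V⟩ :=
    precise_refinement V hVo (iUnion_eq_univ_iff.2 fun x => ⟨x, hxV x⟩)
  -- The shrinking lemma on the normal space `X`: the sets `U x` still cover, with closures inside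
  -- `V' x ⊆ V x`.
  obtain ⟨U, hUc, hUo, hUV⟩ :=
    exists_iUnion_eq_closure_subset hV'o (fun x => hV'lf.point_finite x) hV'c
  refine ⟨fun α s hso hsc => ?_⟩
  have hcov : ∀ x, ⋃ a, (Subtype.val ⁻¹' s a : Set (q ⁻¹' V x)) = univ := fun x => by
    rw [← preimage_iUnion, hsc, preimage_univ]
  choose T hTo hTc hTlf hTs using fun x =>
    precise_refinement (fun a => (Subtype.val ⁻¹' s a : Set (q ⁻¹' V x)))
      (fun a => (hso a).preimage continuous_subtype_val) (hcov x)
  have hemb : ∀ x, IsOpenEmbedding (Subtype.val : q ⁻¹' V x → Y) := fun x =>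
    ((hVo x).preimage hq).isOpenEmbedding_subtypeVal
  refine ⟨α, fun a => ⋃ x, Subtype.val '' T x a ∩ q ⁻¹' U x, fun a => ?_, ?_, fun y => ?_,
    fun a => ⟨a, ?_⟩⟩
  · exact isOpen_iUnion fun x => ((hemb x).isOpenMap _ (hTo x a)).inter ((hUo x).preimage hq)
  · refine iUnion_eq_univ_iff.2 fun y => ?_
    obtain ⟨x, hx⟩ := iUnion_eq_univ_iff.1 hUc (q y)
    have hyV : y ∈ q ⁻¹' V x := hV'V x (hUV x (subset_closure hx))
    obtain ⟨a, ha⟩ := iUnion_eq_univ_iff.1 (hTc x) ⟨y, hyV⟩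
    exact ⟨a, mem_iUnion.2 ⟨x, ⟨_, ha, rfl⟩, hx⟩⟩
  · obtain ⟨N, hN, hfin⟩ := hV'lf (q y)
    -- For a single index `x`: over `V x` use local finiteness of the refinement chosen there;
    -- elsewhere `q y` avoids the closure of `U x`, so a neighbourhood of `y` meets nothing. Only
    -- the finitely many `x` whose `V' x` meets `N` have to be treated together.
    have hM : ∀ x, ∃ M ∈ 𝓝 y, {a | (Subtype.val '' T x a ∩ q ⁻¹' U x ∩ M).Nonempty}.Finite := by
      intro x
      by_cases hy : q y ∈ V x
      · obtain ⟨t, ht, htf⟩ := hTlf x ⟨y, hy⟩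
        refine ⟨Subtype.val '' t, (hemb x).image_mem_nhds.2 ht, htf.subset ?_⟩
        rintro a ⟨_, ⟨⟨z, hz, rfl⟩, _⟩, z', hz', he⟩
        exact ⟨z, hz, Subtype.ext he ▸ hz'⟩
      · refine ⟨q ⁻¹' (closure (U x))ᶜ, (isClosed_closure.isOpen_compl.preimage hq).mem_nhds
          fun hc => hy (hV'V x (hUV x hc)), finite_empty.subset ?_⟩
        rintro a ⟨z, ⟨_, hz⟩, hz'⟩
        exact hz' (subset_closure hz)
    choose M hM hMf using hM
    refine ⟨q ⁻¹' N ∩ ⋂ x ∈ {x | (V' x ∩ N).Nonempty}, M x,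
      inter_mem (hq.continuousAt hN) ((biInter_mem hfin).2 fun x _ => hM x),
      (hfin.biUnion fun x _ => hMf x).subset ?_⟩
    rintro a ⟨z, hz, hzN, hzM⟩
    obtain ⟨x, hx⟩ := mem_iUnion.1 hz
    have hxS : x ∈ {x | (V' x ∩ N).Nonempty} := ⟨q z, hUV x (subset_closure hx.2), hzN⟩
    exact mem_biUnion hxS ⟨z, hx, mem_iInter₂.1 hzM x hxS⟩
  · refine iUnion_subset fun x => ?_
    rintro _ ⟨⟨z, hz, rfl⟩, _⟩
    exact hTs x a hz

/-! ### Charts -/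

section Charts

variable {X : Type v} {Y : Type w}

theorem localRep_apply {φ : MChart.{u} X} {ψ : MChart.{u} Y} {f : X → Y}
    (hφ : InjOn φ.toFun φ.dom) {x : X} (hx : x ∈ φ.dom) :
    localRep φ ψ f (φ.toFun x) = ψ.toFun (f x) := by
  have h : ∃ z, ∃ x' ∈ φ.dom, φ.toFun x' = φ.toFun x ∧ z = ψ.toFun (f x') :=
    ⟨_, x, hx, rfl, rfl⟩
  obtain ⟨x', hx', he, hz⟩ := Classical.epsilon_spec h
  rw [hφ hx' hx he] at hz
  exact hz

theorem transition_apply {φ ψ : MChart.{u} X} (hφ : InjOn φ.toFun φ.dom) {x : X}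
    (hx : x ∈ φ.dom) : transition φ ψ (φ.toFun x) = ψ.toFun x :=
  localRep_apply (f := id) hφ hx

namespace MChart.IsChart

variable [TopologicalSpace X] {φ : MChart.{u} X}

theorem isOpen (h : φ.IsChart) : IsOpen φ.dom := h.1

theorem isScRetract (h : φ.IsChart) : IsScRetract φ.E φ.C φ.O := h.2.1

theorem image_dom (h : φ.IsChart) : φ.toFun '' φ.dom = φ.O := h.2.2.1

theorem injOn (h : φ.IsChart) : InjOn φ.toFun φ.dom :=
  injOn_iff_injective.2 h.2.2.2.injective

theorem continuousOn (h : φ.IsChart) : ContinuousOn φ.toFun φ.dom :=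
  continuousOn_iff_continuous_domRestrict.2 h.2.2.2.continuous

theorem isOpen_preimage (h : φ.IsChart) {W : Set (φ.E.lvl 0)} (hW : IsOpen W) :
    IsOpen (φ.dom ∩ φ.toFun ⁻¹' W) :=
  h.continuousOn.isOpen_inter_preimage h.isOpen hW

theorem exists_isOpen_forall_mem_iff (h : φ.IsChart) {A : Set X} (hA : IsOpen A) :
    ∃ W, IsOpen W ∧ ∀ x ∈ φ.dom, φ.toFun x ∈ W ↔ x ∈ A := by
  obtain ⟨W, hW, he⟩ := h.2.2.2.isInducing.isOpen_iff.1 (hA.preimage continuous_subtype_val)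
  exact ⟨W, hW, fun x hx => Set.ext_iff.1 he ⟨x, hx⟩⟩

theorem exists_isOpen_image_inter (h : φ.IsChart) {A : Set X} (hA : IsOpen A) :
    ∃ W, IsOpen W ∧ ∀ B ⊆ φ.dom, φ.toFun '' (B ∩ A) = φ.toFun '' B ∩ W := by
  obtain ⟨W, hW, hiff⟩ := h.exists_isOpen_forall_mem_iff hA
  refine ⟨W, hW, fun B hB => ?_⟩
  ext y
  constructor
  · rintro ⟨x, hx, rfl⟩
    exact ⟨⟨x, hx.1, rfl⟩, (hiff x (hB hx.1)).2 hx.2⟩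
  · rintro ⟨⟨x, hx, rfl⟩, hxW⟩
    exact ⟨x, ⟨hx, (hiff x (hB hx)).1 hxW⟩, rfl⟩

theorem isScRetract_image (h : φ.IsChart) {A : Set X} (hA : IsOpen A) :
    IsScRetract φ.E φ.C (φ.toFun '' (φ.dom ∩ A)) := by
  obtain ⟨W, hW, hi⟩ := h.exists_isOpen_image_inter hA
  rw [hi _ Subset.rfl, h.image_dom]
  exact h.isScRetract.inter_open hW

theorem smooth_mono (h : φ.IsChart) {A B : Set X} (hA : IsOpen A) (hB : B ⊆ φ.dom) (hAB : A ⊆ B)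
    {F : ScBanach.{w}} {f : φ.E.lvl 0 → F.lvl 0}
    (hf : IsScSmoothOnRetract φ.C (φ.toFun '' B) f) :
    IsScSmoothOnRetract φ.C (φ.toFun '' A) f := by
  obtain ⟨W, hW, hi⟩ := h.exists_isOpen_image_inter hA
  have := hf.inter_open hW
  rwa [← hi B hB, inter_eq_self_of_subset_right hAB] at this

/-- Any part of a chart domain embeds in a Banach space, so it is metrizable, and metrizable spaces
are paracompact. -/
theorem paracompactSpace_subset (h : φ.IsChart) {A : Set X} (hA : A ⊆ φ.dom) :
    ParacompactSpace A := by
  have h1 : IsEmbedding (φ.dom.domRestrict φ.toFun ∘ inclusion hA) :=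
    h.2.2.2.comp (IsEmbedding.inclusion hA)
  have := h1.metrizableSpace
  let := TopologicalSpace.metrizableSpaceMetric A
  infer_instance

end MChart.IsChart

/-- Hausdorff and paracompactness for a space `Y` over a paracompact Hausdorff space `X`, such that
chart domains contain the preimages of small open sets of `X`. -/
theorem t2Space_and_paracompactSpace_of_charts [TopologicalSpace X] [TopologicalSpace Y]
    [ParacompactSpace X] [T2Space X] {q : Y → X} (hq : Continuous q)
    (h : ∀ x, ∃ V, IsOpen V ∧ x ∈ V ∧ ∃ φ : MChart.{u} Y, φ.IsChart ∧ q ⁻¹' V ⊆ φ.dom) :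
    T2Space Y ∧ ParacompactSpace Y := by
  refine ⟨⟨fun y z hyz => ?_⟩, paracompactSpace_of_continuous hq fun x => ?_⟩
  -- Points of the same fibre lie in a common chart domain and are separated in the Banach space;
  -- points of different fibres are separated in `X`.
  · by_cases hqq : q y = q z
    · obtain ⟨V, hV, hyV, φ, hφ, hdom⟩ := h (q y)
      have hy : y ∈ φ.dom := hdom hyV
      have hz : z ∈ φ.dom := hdom (show q z ∈ V from hqq ▸ hyV)
      obtain ⟨A, B, hA, hB, hyA, hzB, hAB⟩ := t2_separation (fun he => hyz (hφ.injOn hy hz he))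
      refine ⟨_, _, hφ.isOpen_preimage hA, hφ.isOpen_preimage hB, ⟨hy, hyA⟩, ⟨hz, hzB⟩, ?_⟩
      exact (hAB.preimage φ.toFun).mono inter_subset_right inter_subset_right
    · obtain ⟨A, B, hA, hB, hyA, hzB, hAB⟩ := t2_separation hqq
      exact ⟨_, _, hA.preimage hq, hB.preimage hq, hyA, hzB, hAB.preimage q⟩
  · obtain ⟨V, hV, hxV, φ, hφ, hdom⟩ := h x
    exact ⟨V, hV, hxV, hφ.paracompactSpace_subset hdom⟩

/-- Gluing: bijections onto sc-retracts with open overlaps and sc-smooth transition maps are an atlas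
for the topology generated by the preimages of open sets, and these preimages are a basis. -/
theorem isTopologicalBasis_and_isAtlas_of_gluing [tY : TopologicalSpace Y]
    {ℬ : Set (MChart.{u} Y)} (htop : tY = TopologicalSpace.generateFrom (chartPreimages ℬ))
    (hret : ∀ φ ∈ ℬ, IsScRetract φ.E φ.C φ.O) (him : ∀ φ ∈ ℬ, φ.toFun '' φ.dom = φ.O)
    (hinj : ∀ φ ∈ ℬ, InjOn φ.toFun φ.dom) (hcomp : ∀ φ ∈ ℬ, ∀ ψ ∈ ℬ, Compatible φ ψ)
    (hopen : ∀ φ ∈ ℬ, ∀ ψ ∈ ℬ, ∃ W, IsOpen W ∧ overlap φ ψ = φ.O ∩ W)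
    (hcov : ∀ y, ∃ φ ∈ ℬ, y ∈ φ.dom) :
    TopologicalSpace.IsTopologicalBasis (chartPreimages ℬ) ∧ IsAtlas ℬ := by
  -- Seen in `φ`, a basic set of `ψ` is relatively open: `hopen` cuts out the overlap, and
  -- continuity of the transition map handles `W'`. Both the basis property and the embedding
  -- property follow from this.
  have key : ∀ φ ∈ ℬ, ∀ ψ ∈ ℬ, ∀ W', IsOpen W' → ∃ W, IsOpen W ∧
      ∀ y ∈ φ.dom, φ.toFun y ∈ W ↔ y ∈ ψ.dom ∩ ψ.toFun ⁻¹' W' := by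
    intro φ hφ ψ hψ W' hW'
    obtain ⟨W, hW, hov⟩ := hopen φ hφ ψ hψ
    obtain ⟨W₁, hW₁, he⟩ := continuousOn_iff'.1 (hcomp φ hφ ψ hψ).1.continuousOn W' hW'
    refine ⟨W₁ ∩ W, hW₁.inter hW, fun y hy => ?_⟩
    have h1 : φ.toFun y ∈ W ↔ y ∈ ψ.dom := by
      have hyO : φ.toFun y ∈ φ.O := him φ hφ ▸ mem_image_of_mem _ hy
      constructor
      · intro h
        have : φ.toFun y ∈ overlap φ ψ := hov ▸ ⟨hyO, h⟩
        obtain ⟨z, hz, hzy⟩ := this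
        exact hinj φ hφ hz.1 hy hzy ▸ hz.2
      · intro h
        have : φ.toFun y ∈ overlap φ ψ := ⟨y, ⟨hy, h⟩, rfl⟩
        exact (hov ▸ this).2
    have h2 : y ∈ ψ.dom → (φ.toFun y ∈ W₁ ↔ ψ.toFun y ∈ W') := by
      intro h
      have h3 : φ.toFun y ∈ overlap φ ψ := ⟨y, ⟨hy, h⟩, rfl⟩
      have h4 := Set.ext_iff.1 he (φ.toFun y)
      simp only [mem_inter_iff, mem_preimage, h3, and_true, transition_apply (hinj φ hφ) hy] at h4
      exact h4.symm
    rw [mem_inter_iff, h1, mem_inter_iff, mem_preimage]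
    constructor
    · rintro ⟨h3, h4⟩
      exact ⟨h4, (h2 h4).1 h3⟩
    · rintro ⟨h3, h4⟩
      exact ⟨(h2 h3).2 h4, h3⟩
  have hgen : ∀ φ ∈ ℬ, ∀ W, IsOpen W → IsOpen (φ.dom ∩ φ.toFun ⁻¹' W) := by
    intro φ hφ W hW
    rw [htop]
    exact TopologicalSpace.isOpen_generateFrom_of_mem ⟨φ, hφ, W, hW, rfl⟩
  refine ⟨⟨?_, ?_, htop⟩, fun φ hφ => ⟨?_, hret φ hφ, him φ hφ, ⟨⟨le_antisymm ?_ ?_⟩, ?_⟩⟩,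
    hcomp, hcov⟩
  · rintro _ ⟨φ, hφ, W, hW, rfl⟩ _ ⟨ψ, hψ, W', hW', rfl⟩ y hy
    obtain ⟨W₁, hW₁, hiff⟩ := key φ hφ ψ hψ W' hW'
    refine ⟨_, ⟨φ, hφ, W ∩ W₁, hW.inter hW₁, rfl⟩,
      ⟨hy.1.1, hy.1.2, (hiff y hy.1.1).2 hy.2⟩, fun z hz => ⟨⟨hz.1, hz.2.1⟩, ?_⟩⟩
    exact (hiff z hz.1).1 hz.2.2
  · refine sUnion_eq_univ_iff.2 fun y => ?_
    obtain ⟨φ, hφ, hy⟩ := hcov y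
    exact ⟨_, ⟨φ, hφ, univ, isOpen_univ, rfl⟩, hy, trivial⟩
  · simpa using hgen φ hφ univ isOpen_univ
  · refine Continuous.le_induced (continuous_def.2 fun W hW => ?_)
    refine ⟨_, hgen φ hφ W hW, ?_⟩
    ext y
    exact ⟨fun h => h.2, fun h => ⟨y.2, h⟩⟩
  -- The traces of all chart preimages generate the subspace topology, and `key` rewrites each of
  -- them as a preimage under `φ` alone.
  · rw [instTopologicalSpaceSubtype, htop, induced_generateFrom_eq]
    refine le_generateFrom ?_
    rintro _ ⟨_, ⟨ψ, hψ, W', hW', rfl⟩, rfl⟩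
    obtain ⟨W₁, hW₁, hiff⟩ := key φ hφ ψ hψ W' hW'
    refine ⟨W₁, hW₁, ?_⟩
    ext y
    exact hiff y y.2
  · exact injOn_iff_injective.1 (hinj φ hφ)

/-- A map which is sc-smooth in suitable charts is sc-smooth. -/
theorem isScSmoothMap_of_charts [TopologicalSpace X] [TopologicalSpace Y]
    {𝒜 : Set (MChart.{u} X)} {ℬ : Set (MChart.{u} Y)} (h𝒜 : IsAtlas 𝒜) (hℬ : IsAtlas ℬ)
    {f : X → Y} (h : ∀ x, ∃ φ ∈ 𝒜, ∃ ψ ∈ ℬ, x ∈ φ.dom ∧ f x ∈ ψ.dom ∧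
      IsOpen (φ.dom ∩ f ⁻¹' ψ.dom) ∧
      IsScSmoothOnRetract φ.C (φ.toFun '' (φ.dom ∩ f ⁻¹' ψ.dom)) (localRep φ ψ f)) :
    IsScSmoothMap 𝒜 ℬ f := by
  have hcont : Continuous f := by
    refine continuous_iff_continuousAt.2 fun x => ?_
    obtain ⟨φ, hφ, ψ, hψ, hx, hfx, ho, hs⟩ := h x
    have hcφ := h𝒜.1 φ hφ
    have hcψ := hℬ.1 ψ hψ
    have h1 : ContinuousOn (fun z => ψ.toFun (f z)) (φ.dom ∩ f ⁻¹' ψ.dom) := by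
      refine (hs.continuousOn.comp (hcφ.continuousOn.mono inter_subset_left)
        (mapsTo_image _ _)).congr fun z hz => ?_
      exact (localRep_apply hcφ.injOn hz.1).symm
    refine continuousAt_def.2 fun N hN => ?_
    obtain ⟨N', hN', hoN', hxN'⟩ := mem_nhds_iff.1 hN
    obtain ⟨W, hW, hiff⟩ := hcψ.exists_isOpen_forall_mem_iff hoN'
    refine mem_of_superset ((h1.isOpen_inter_preimage ho hW).mem_nhds
      ⟨⟨hx, hfx⟩, (hiff _ hfx).2 hxN'⟩) fun z hz => hN' ((hiff _ hz.1.2).1 hz.2)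
  refine ⟨hcont, ?_⟩
  rintro φ' ⟨𝒜', h𝒜', hφ'⟩ ψ' ⟨ℬ', hℬ', hψ'⟩
  have hcφ' := h𝒜'.2.1.1 φ' hφ'
  have hcψ' := hℬ'.2.1.1 ψ' hψ'
  have hM : IsOpen (f ⁻¹' ψ'.dom) := hcψ'.isOpen.preimage hcont
  refine IsScSmoothOnRetract.of_local (hcφ'.isScRetract_image hM) ?_
  rintro _ ⟨x, hx, rfl⟩
  obtain ⟨φ, hφ, ψ, hψ, hxφ, hfx, ho, hs⟩ := h x
  have hcφ := h𝒜.1 φ hφ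
  have hcψ := hℬ.1 ψ hψ
  obtain ⟨W, hW, hi⟩ := hcφ'.exists_isOpen_image_inter ho
  have hi' := hi (φ'.dom ∩ f ⁻¹' ψ'.dom) inter_subset_left
  set N := φ'.dom ∩ f ⁻¹' ψ'.dom ∩ (φ.dom ∩ f ⁻¹' ψ.dom) with hN
  have hNo : IsOpen N := (hcφ'.isOpen.inter hM).inter ho
  refine ⟨W, hW, ?_, ?_⟩
  · have : φ'.toFun x ∈ φ'.toFun '' N := ⟨x, ⟨hx, hxφ, hfx⟩, rfl⟩
    rw [hi'] at this
    exact this.2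
  rw [← hi']
  -- Near the point, the representative in arbitrary charts factors as `(ψ' ∘ ψ⁻¹) ∘ (ψ ∘ f ∘ φ⁻¹) ∘
  -- (φ ∘ φ'⁻¹)`; the outer factors are sc-smooth because the unions of equivalent atlases are
  -- atlases.
  have hc1 := (h𝒜'.2.2.2.1 φ' (Or.inr hφ') φ (Or.inl hφ)).1
  have hc2 := (hℬ'.2.2.2.1 ψ (Or.inl hψ) ψ' (Or.inr hψ')).1
  have s1 : IsScSmoothOnRetract φ'.C (φ'.toFun '' N) (transition φ' φ) :=
    hcφ'.smooth_mono hNo inter_subset_left (fun z hz => ⟨hz.1.1, hz.2.1⟩) hc1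
  have s2 := hs.comp s1 (by
    rintro _ ⟨z, hz, rfl⟩
    rw [transition_apply hcφ'.injOn hz.1.1]
    exact ⟨z, hz.2, rfl⟩)
  have s3 := hc2.comp s2 (by
    rintro _ ⟨z, hz, rfl⟩
    rw [Function.comp, transition_apply hcφ'.injOn hz.1.1, localRep_apply hcφ.injOn hz.2.1]
    exact ⟨f z, ⟨hz.2.2, hz.1.2⟩, rfl⟩)
  refine s3.congr ?_
  rintro _ ⟨z, hz, rfl⟩
  rw [Function.comp, Function.comp, transition_apply hcφ'.injOn hz.1.1,
    localRep_apply hcφ.injOn hz.2.1, transition_apply hcψ.injOn hz.2.2,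
    localRep_apply hcφ'.injOn hz.1.1]

end Charts

theorem MTangent.proj_eq_of_related {X : Type v} {𝒜 𝒜' : Set (MChart.{u} X)}
    {e : MTangent 𝒜 → MTangent 𝒜'}
    (he : ∀ t t', e (MTangent.mk t) = MTangent.mk t' ↔ Related t t') (v : MTangent 𝒜) :
    (MTangent.proj (e v)).1 = (MTangent.proj v).1 := by
  induction v using Quot.ind with | mk t => ?_
  obtain ⟨t', ht'⟩ := Quot.exists_rep (e (MTangent.mk t))
  have h1 : Related t t' := (he t t').1 ht'.symm
  change (MTangent.proj (e (MTangent.mk t))).1 = _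
  rw [← ht']
  exact h1.1.symm

/-! ### Shifted and tangent structures, relative to an ambient atlas `𝒰` -/

section Bundles

variable {X : Type v} [TopologicalSpace X] {𝒰 𝒜 𝒜' 𝒜'' : Set (MChart.{u} X)}

/-! ### Transition maps of an atlas -/

namespace IsAtlas

variable {φ ψ : MChart.{u} X}

theorem smooth_transition (h : IsAtlas 𝒰) (hφ : φ ∈ 𝒰) (hψ : ψ ∈ 𝒰) :
    IsScSmoothOnRetract φ.C (overlap φ ψ) (transition φ ψ) := (h.2.1 φ hφ ψ hψ).1

theorem exists_overlap_eq (h : IsAtlas 𝒰) (hφ : φ ∈ 𝒰) (hψ : ψ ∈ 𝒰) :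
    ∃ W, IsOpen W ∧ overlap φ ψ = φ.O ∩ W := by
  obtain ⟨W, hW, hi⟩ := (h.1 φ hφ).exists_isOpen_image_inter (h.1 ψ hψ).isOpen
  exact ⟨W, hW, (hi _ Subset.rfl).trans (by rw [(h.1 φ hφ).image_dom])⟩

theorem mapsTo_transition (h : IsAtlas 𝒰) (hφ : φ ∈ 𝒰) :
    MapsTo (transition φ ψ) (overlap φ ψ) (overlap ψ φ) := by
  rintro _ ⟨x, hx, rfl⟩
  rw [transition_apply (h.1 φ hφ).injOn hx.1]
  exact ⟨x, hx.symm, rfl⟩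

theorem overlap_subset (h : IsAtlas 𝒰) (hφ : φ ∈ 𝒰) : overlap φ ψ ⊆ φ.O := by
  rw [← (h.1 φ hφ).image_dom]
  exact image_mono inter_subset_left

/-- The level of a point does not depend on the chart, since sc-smooth transition maps preserve
levels. -/
theorem mem_range_toBase (h : IsAtlas 𝒰) (hφ : φ ∈ 𝒰) (hψ : ψ ∈ 𝒰) {x : X} (hx : x ∈ φ.dom)
    (hx' : x ∈ ψ.dom) {m : ℕ} (hm : φ.toFun x ∈ range (φ.E.toBase m)) :
    ψ.toFun x ∈ range (ψ.E.toBase m) := by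
  obtain ⟨y, hy⟩ := hm
  have := (h.smooth_transition hφ hψ).mem_range_toBase (x := y)
    (by rw [hy]; exact ⟨x, ⟨hx, hx'⟩, rfl⟩)
  rwa [hy, transition_apply (h.1 φ hφ).injOn hx] at this

theorem toFun_mem_range (h : IsAtlas 𝒰) (h𝒜 : 𝒜 ⊆ 𝒰) (hφ : φ ∈ 𝒰) {m : ℕ} {x : X}
    (hx : x ∈ levelSet 𝒜 m) (hxφ : x ∈ φ.dom) : φ.toFun x ∈ range (φ.E.toBase m) := by
  obtain ⟨ψ, hψ, hxψ, hm⟩ := hx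
  exact h.mem_range_toBase (h𝒜 hψ) hφ hxψ hxφ hm

theorem levelSet_subset (h : IsAtlas 𝒰) (h𝒜 : 𝒜 ⊆ 𝒰) (h𝒜' : 𝒜' ⊆ 𝒰)
    (hcov : ∀ x, ∃ φ ∈ 𝒜', x ∈ φ.dom) (m : ℕ) : levelSet 𝒜 m ⊆ levelSet 𝒜' m := fun x hx => by
  obtain ⟨φ, hφ, hxφ⟩ := hcov x
  exact ⟨φ, hφ, hxφ, h.toFun_mem_range h𝒜 (h𝒜' hφ) hx hxφ⟩

/-! ### The shifted M-polyfold -/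

theorem toBase_shiftedChart (h : IsAtlas 𝒜) (hφ : φ ∈ 𝒜) {x : Shifted 𝒜} (hx : x.1 ∈ φ.dom) :
    φ.E.toBase 1 ((shiftedChart 𝒜 φ).toFun x) = φ.toFun x.1 :=
  φ.E.toBase_lift (h.toFun_mem_range Subset.rfl hφ x.2 hx)

theorem injOn_shiftedChart (h : IsAtlas 𝒜) (hφ : φ ∈ 𝒜) :
    InjOn (shiftedChart 𝒜 φ).toFun (shiftedChart 𝒜 φ).dom := fun x hx y hy hxy =>
  Subtype.ext ((h.1 φ hφ).injOn hx hy (by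
    rw [← h.toBase_shiftedChart hφ hx, ← h.toBase_shiftedChart hφ hy, hxy]))

theorem image_shiftedChart (h : IsAtlas 𝒜) (hφ : φ ∈ 𝒜) (A : Set X) :
    (shiftedChart 𝒜 φ).toFun '' {x | x.1 ∈ φ.dom ∩ A} =
      φ.E.part (φ.toFun '' (φ.dom ∩ A)) 1 := by
  ext y
  constructor
  · rintro ⟨x, hx, rfl⟩
    exact ⟨x.1, hx, (h.toBase_shiftedChart hφ hx.1).symm⟩
  · rintro ⟨x, hx, hxy⟩
    refine ⟨⟨x, φ, hφ, hx.1, y, hxy.symm⟩, hx, φ.E.toBase_injective 1 ?_⟩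
    exact (h.toBase_shiftedChart hφ hx.1).trans hxy

/-- The representative is the first level map of the original transition map. Allowing any `f` over
the identity of `X` covers both the transitions of `X¹` and the comparison of two atlases. -/
theorem smooth_localRep_shiftedChart (h𝒰 : IsAtlas 𝒰) (h : IsAtlas 𝒜) (h' : IsAtlas 𝒜')
    (h𝒜 : 𝒜 ⊆ 𝒰) (h𝒜' : 𝒜' ⊆ 𝒰) {f : Shifted 𝒜 → Shifted 𝒜'} (hf : ∀ x, (f x).1 = x.1)
    (hφ : φ ∈ 𝒜) (hψ : ψ ∈ 𝒜') :
    IsScSmoothOnRetract (shiftedChart 𝒜 φ).C ((shiftedChart 𝒜 φ).toFun ''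
        ((shiftedChart 𝒜 φ).dom ∩ f ⁻¹' (shiftedChart 𝒜' ψ).dom))
      (localRep (shiftedChart 𝒜 φ) (shiftedChart 𝒜' ψ) f) := by
  have hdom : (shiftedChart 𝒜 φ).dom ∩ f ⁻¹' (shiftedChart 𝒜' ψ).dom =
      {x | x.1 ∈ φ.dom ∩ ψ.dom} := by
    ext x
    exact and_congr_right fun _ => iff_of_eq (congrArg (· ∈ ψ.dom) (hf x))
  have hs := h𝒰.smooth_transition (h𝒜 hφ) (h𝒜' hψ)
  have him := h.image_shiftedChart hφ ψ.dom
  rw [hdom]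
  have hs1 : IsScSmoothOnRetract (shiftedChart 𝒜 φ).C
      ((shiftedChart 𝒜 φ).toFun '' {x | x.1 ∈ φ.dom ∩ ψ.dom})
      (F := ψ.E.shift) (levelMap (transition φ ψ) 1) := by
    rw [him]
    exact hs.shift
  refine hs1.congr ?_
  rintro _ ⟨x, hx, rfl⟩
  have hfx : (f x).1 ∈ ψ.dom := by
    rw [hf x]
    exact hx.2
  rw [localRep_apply (h.injOn_shiftedChart hφ) hx.1]
  apply levelMap_eq
  rw [h'.toBase_shiftedChart hψ hfx, h.toBase_shiftedChart hφ hx.1,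
    transition_apply (h.1 φ hφ).injOn hx.1, hf x]

theorem shifted_gluing (h : IsAtlas 𝒜) :
    TopologicalSpace.IsTopologicalBasis (chartPreimages (shiftedAtlas 𝒜)) ∧
      IsAtlas (shiftedAtlas 𝒜) := by
  have him : ∀ φ ∈ 𝒜, (shiftedChart 𝒜 φ).toFun '' (shiftedChart 𝒜 φ).dom =
      φ.E.part φ.O 1 := by
    intro φ hφ
    have := h.image_shiftedChart hφ univ
    rwa [inter_univ, (h.1 φ hφ).image_dom] at this
  apply isTopologicalBasis_and_isAtlas_of_gluing rfl
  · rintro _ ⟨φ, hφ, rfl⟩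
    exact (h.1 φ hφ).isScRetract.shift
  · rintro _ ⟨φ, hφ, rfl⟩
    exact him φ hφ
  · rintro _ ⟨φ, hφ, rfl⟩
    exact h.injOn_shiftedChart hφ
  · rintro _ ⟨φ, hφ, rfl⟩ _ ⟨ψ, hψ, rfl⟩
    exact ⟨h.smooth_localRep_shiftedChart (f := id) h h Subset.rfl Subset.rfl (fun _ => rfl) hφ hψ,
      h.smooth_localRep_shiftedChart (f := id) h h Subset.rfl Subset.rfl (fun _ => rfl) hψ hφ⟩
  · rintro _ ⟨φ, hφ, rfl⟩ _ ⟨ψ, hψ, rfl⟩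
    obtain ⟨W, hW, hov⟩ := h.exists_overlap_eq hφ hψ
    refine ⟨φ.E.part W 1, φ.E.isOpen_part hW 1, (h.image_shiftedChart hφ ψ.dom).trans ?_⟩
    exact congrArg (fun A => φ.E.part A 1) hov
  · intro x
    obtain ⟨φ, hφ, hx⟩ := h.2.2 x.1
    exact ⟨_, ⟨φ, hφ, rfl⟩, hx⟩

/-- In charts this is the bounded inclusion `E_1 → E_0`. -/
theorem continuous_val_shifted (h : IsAtlas 𝒜) : Continuous fun x : Shifted 𝒜 => x.1 := by
  refine continuous_def.2 fun A hA => isOpen_iff_mem_nhds.2 fun x hx => ?_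
  obtain ⟨φ, hφ, hxφ⟩ := h.2.2 x.1
  obtain ⟨W, hW, hiff⟩ := (h.1 φ hφ).exists_isOpen_forall_mem_iff hA
  have ho : IsOpen ((shiftedChart 𝒜 φ).dom ∩ (shiftedChart 𝒜 φ).toFun ⁻¹' (φ.E.part W 1)) :=
    TopologicalSpace.isOpen_generateFrom_of_mem
      ⟨_, ⟨φ, hφ, rfl⟩, _, φ.E.isOpen_part hW 1, rfl⟩
  have hmem : ∀ y : Shifted 𝒜, y.1 ∈ φ.dom →
      ((shiftedChart 𝒜 φ).toFun y ∈ φ.E.part W 1 ↔ y.1 ∈ A) := fun y hy => by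
    exact (iff_of_eq (congrArg (· ∈ W) (h.toBase_shiftedChart hφ hy))).trans (hiff _ hy)
  exact Filter.mem_of_superset (ho.mem_nhds ⟨hxφ, (hmem x hxφ).2 hx⟩)
    fun y hy => (hmem y hy.1).1 hy.2

/-! ### The relation on tangent tuples -/

theorem mem_tangentRetract_overlap (h : IsAtlas 𝒰) {t : TangentTuple 𝒜} (ht : t.chart ∈ 𝒰)
    (hψ : ψ ∈ 𝒰) (hpt : t.pt ∈ ψ.dom) :
    (t.base, t.vec) ∈ tangentRetract t.chart.C (overlap t.chart ψ) := by
  obtain ⟨W, hW, hov⟩ := h.exists_overlap_eq ht hψ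
  rw [hov, tangentRetract_inter_open (h.1 _ ht).isScRetract hW]
  refine ⟨t.vec_mem, ?_⟩
  have : t.chart.toFun t.pt ∈ overlap t.chart ψ := ⟨t.pt, ⟨t.pt_mem, hpt⟩, rfl⟩
  rw [hov, ← t.base_eq] at this
  exact this.2

theorem transition_base (h : IsAtlas 𝒰) {t : TangentTuple 𝒜} (ht : t.chart ∈ 𝒰) :
    transition t.chart ψ (t.chart.E.toBase 1 t.base) = ψ.toFun t.pt := by
  rw [t.base_eq, transition_apply (h.1 _ ht).injOn t.pt_mem]

/-- A tangent vector is carried into another chart by the derivative of the transition map, whose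
values are again tangent to the target retract. -/
theorem exists_related (h : IsAtlas 𝒰) (h𝒜 : 𝒜 ⊆ 𝒰) (h𝒜' : 𝒜' ⊆ 𝒰) (t : TangentTuple 𝒜)
    (hψ : ψ ∈ 𝒜') (hpt : t.pt ∈ ψ.dom) :
    ∃ t' : TangentTuple 𝒜', t'.chart = ψ ∧ Related t t' := by
  have ht := h𝒜 t.chart_mem
  have hs := h.smooth_transition ht (h𝒜' hψ)
  have hp := h.mem_tangentRetract_overlap ht (h𝒜' hψ) hpt
  obtain ⟨η, hη⟩ := hs.exists_hasRetractDeriv hp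
  obtain ⟨y, hy⟩ := hs.mem_range_toBase hη.toBase_mem
  have hm := hη.mem_tangentRetract hs.1 (h.1 ψ (h𝒜' hψ)).isScRetract hy
    ((h.mapsTo_transition ht).mono_right (h.overlap_subset (h𝒜' hψ)))
  exact ⟨⟨ψ, hψ, t.pt, hpt, y, hy.trans (h.transition_base ht), η, hm⟩, rfl, rfl, hη⟩

theorem hasRetractDeriv_transition_self (h : IsAtlas 𝒰) {t : TangentTuple 𝒜}
    (ht : t.chart ∈ 𝒰) :
    HasRetractDeriv t.chart.C (overlap t.chart t.chart) (transition t.chart t.chart) t.base t.vec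
      t.vec := by
  refine (hasRetractDeriv_id (h.1 _ ht).isScRetract.1
    (h.mem_tangentRetract_overlap ht ht t.pt_mem)).congr ?_
  rintro _ ⟨x, hx, rfl⟩
  exact (transition_apply (h.1 _ ht).injOn hx.1).symm

/-- The two transition maps compose to the identity, so by the chain rule and uniqueness the
derivative of the inverse returns the original vector. -/
theorem related_symm (h : IsAtlas 𝒰) (h𝒜 : 𝒜 ⊆ 𝒰) (h𝒜' : 𝒜' ⊆ 𝒰) {t : TangentTuple 𝒜}
    {t' : TangentTuple 𝒜'} (htt : Related t t') : Related t' t := by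
  have ht := h𝒜 t.chart_mem
  have ht' := h𝒜' t'.chart_mem
  have hs := h.smooth_transition ht' ht
  have hp := h.mem_tangentRetract_overlap ht' ht (ψ := t.chart) (htt.1 ▸ t.pt_mem)
  obtain ⟨ζ, hζ⟩ := hs.exists_hasRetractDeriv hp
  have hC := (h.1 _ ht).isScRetract.1
  have hb : t'.chart.E.toBase 1 t'.base =
      transition t.chart t'.chart (t.chart.E.toBase 1 t.base) := by
    rw [h.transition_base ht, htt.1, t'.base_eq]
  have hc := hζ.comp htt.2 hC hs.1 hb (h.mapsTo_transition ht)
  have hid : EqOn (transition t'.chart t.chart ∘ transition t.chart t'.chart) id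
      (overlap t.chart t'.chart) := by
    rintro _ ⟨x, hx, rfl⟩
    rw [Function.comp, transition_apply (h.1 _ ht).injOn hx.1,
      transition_apply (h.1 _ ht').injOn hx.2, id]
  have he := (hc.congr hid).unique hC (hasRetractDeriv_id hC htt.2.mem)
  exact ⟨htt.1.symm, he ▸ hζ⟩

theorem related_trans (h : IsAtlas 𝒰) (h𝒜 : 𝒜 ⊆ 𝒰) (h𝒜' : 𝒜' ⊆ 𝒰) (h𝒜'' : 𝒜'' ⊆ 𝒰)
    {t : TangentTuple 𝒜} {t' : TangentTuple 𝒜'} {t'' : TangentTuple 𝒜''} (h₁ : Related t t')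
    (h₂ : Related t' t'') : Related t t'' := by
  have ht := h.1 _ (h𝒜 t.chart_mem)
  have ht' := h.1 _ (h𝒜' t'.chart_mem)
  have ht'' := h.1 _ (h𝒜'' t''.chart_mem)
  -- The cocycle identity holds only on the triple overlap. `W` and `W'` cut it out of the overlaps
  -- with `t''` and `t'` removed respectively: the first derivative is restricted to it, and the
  -- composite is extended from it at the end.
  obtain ⟨W, hW, hi⟩ := ht.exists_isOpen_image_inter ht''.isOpen
  obtain ⟨W', hW', hi'⟩ := ht.exists_isOpen_image_inter ht'.isOpen
  have e₁ := hi (t.chart.dom ∩ t'.chart.dom) inter_subset_left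
  have e₂ := hi' (t.chart.dom ∩ t''.chart.dom) inter_subset_left
  rw [inter_right_comm] at e₂
  have hpt : t.pt ∈ t''.chart.dom := (h₁.1.trans h₂.1) ▸ t''.pt_mem
  have hx : t.chart.E.toBase 1 t.base ∈ W := by
    have : t.chart.toFun t.pt ∈ t.chart.toFun '' (t.chart.dom ∩ t'.chart.dom ∩ t''.chart.dom) :=
      ⟨t.pt, ⟨⟨t.pt_mem, h₁.1 ▸ t'.pt_mem⟩, hpt⟩, rfl⟩
    rw [e₁, ← t.base_eq] at this
    exact this.2
  have hC := ht.isScRetract.1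
  have r₁ : HasRetractDeriv t.chart.C
      (t.chart.toFun '' (t.chart.dom ∩ t'.chart.dom ∩ t''.chart.dom))
      (transition t.chart t'.chart) t.base t.vec t'.vec := by
    rw [e₁]
    exact h₁.2.inter_open hC hW hx
  have hb : t'.chart.E.toBase 1 t'.base =
      transition t.chart t'.chart (t.chart.E.toBase 1 t.base) := by
    rw [h.transition_base (h𝒜 t.chart_mem), h₁.1, t'.base_eq]
  have r₂ := h₂.2.comp r₁ hC ht'.isScRetract.1 hb (by
    rintro _ ⟨x, hx, rfl⟩
    rw [transition_apply ht.injOn hx.1.1]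
    exact ⟨x, ⟨hx.1.2, hx.2⟩, rfl⟩)
  have r₃ := r₂.congr (g := transition t.chart t''.chart) (by
    rintro _ ⟨x, hx, rfl⟩
    rw [Function.comp, transition_apply ht.injOn hx.1.1, transition_apply ht'.injOn hx.1.2,
      transition_apply ht.injOn hx.1.1])
  rw [e₂] at r₃
  exact ⟨h₁.1.trans h₂.1, r₃.of_inter_open
    (h.smooth_transition (h𝒜 t.chart_mem) (h𝒜'' t''.chart_mem)) hW'⟩

theorem equivalence_related (h : IsAtlas 𝒜) :
    Equivalence (Related : TangentTuple 𝒜 → TangentTuple 𝒜 → Prop) where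
  refl t := ⟨rfl, h.hasRetractDeriv_transition_self t.chart_mem⟩
  symm := h.related_symm Subset.rfl Subset.rfl
  trans := h.related_trans Subset.rfl Subset.rfl Subset.rfl

theorem mk_eq_mk (h : IsAtlas 𝒜) {t t' : TangentTuple 𝒜} :
    MTangent.mk t = MTangent.mk t' ↔ Related t t' :=
  ⟨fun he => h.equivalence_related.eqvGen_iff.1 (Quot.eqvGen_exact he), fun ht => Quot.sound ht⟩

/-! ### The charts of the tangent bundle -/

theorem exists_isTangentCoord (h : IsAtlas 𝒜) (hφ : φ ∈ 𝒜) {v : MTangent 𝒜}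
    (hv : (MTangent.proj v).1 ∈ φ.dom) : ∃ q, IsTangentCoord φ v q := by
  induction v using Quot.ind with | mk t => ?_
  obtain ⟨t', rfl, ht'⟩ := h.exists_related Subset.rfl Subset.rfl t hφ hv
  exact ⟨(t'.base, t'.vec), t'.chart_mem, t'.pt, t'.pt_mem, t'.base_eq, t'.vec_mem,
    h.mk_eq_mk.2 ht'⟩

theorem isTangentCoord_toFun (h : IsAtlas 𝒜) (hφ : φ ∈ 𝒜) {v : MTangent 𝒜}
    (hv : (MTangent.proj v).1 ∈ φ.dom) : IsTangentCoord φ v ((tangentChart 𝒜 φ).toFun v) :=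
  Classical.epsilon_spec (h.exists_isTangentCoord hφ hv)

/-- Any coordinate chosen for the class comes from a tuple in the same chart related to `t`; the
self-transition is the identity, so its derivative forces equal vectors. -/
theorem tangentChart_mk (h : IsAtlas 𝒜) (t : TangentTuple 𝒜) :
    (tangentChart 𝒜 t.chart).toFun (MTangent.mk t) = (t.base, t.vec) := by
  obtain ⟨hφ, x, hx, hq, hT, he⟩ := h.isTangentCoord_toFun t.chart_mem
    (v := MTangent.mk t) t.pt_mem
  obtain ⟨hpt, hd⟩ := h.mk_eq_mk.1 he
  refine Prod.ext (t.chart.E.toBase_injective 1 ?_) ?_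
  · have hpt' : t.pt = x := hpt
    rw [t.base_eq, hpt']
    exact hq
  · exact hd.unique (h.1 _ hφ).isScRetract.1 (h.hasRetractDeriv_transition_self t.chart_mem)

theorem injOn_tangentChart (h : IsAtlas 𝒜) (hφ : φ ∈ 𝒜) :
    InjOn (tangentChart 𝒜 φ).toFun (tangentChart 𝒜 φ).dom := by
  intro v hv v' hv' he
  obtain ⟨_, x, hx, hq, hT, hvx⟩ := h.isTangentCoord_toFun hφ hv
  have h' := h.isTangentCoord_toFun hφ hv'
  rw [← he] at h'
  obtain ⟨_, x', hx', hq', hT', hvx'⟩ := h'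
  obtain rfl : x = x' := (h.1 φ hφ).injOn hx hx' (hq.symm.trans hq')
  exact hvx.trans hvx'.symm

/-- Over an open `A` the chart fills the whole tangent retract of the smaller set: every element of
`TO` over it is the coordinate of a tuple formed with `φ` itself. -/
theorem image_tangentChart (h : IsAtlas 𝒜) (hφ : φ ∈ 𝒜) {A : Set X} (hA : IsOpen A) :
    (tangentChart 𝒜 φ).toFun '' {v | (MTangent.proj v).1 ∈ φ.dom ∩ A} =
      tangentRetract φ.C (φ.toFun '' (φ.dom ∩ A)) := by
  have hc := h.1 φ hφ
  obtain ⟨W, hW, hiff⟩ := hc.exists_isOpen_forall_mem_iff hA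
  have hi : φ.toFun '' (φ.dom ∩ A) = φ.O ∩ W := by
    rw [← hc.image_dom]
    ext y
    constructor
    · rintro ⟨x, hx, rfl⟩
      exact ⟨⟨x, hx.1, rfl⟩, (hiff x hx.1).2 hx.2⟩
    · rintro ⟨⟨x, hx, rfl⟩, hxW⟩
      exact ⟨x, ⟨hx, (hiff x hx).1 hxW⟩, rfl⟩
  rw [hi, tangentRetract_inter_open hc.isScRetract hW]
  ext p
  constructor
  · rintro ⟨v, hv, rfl⟩
    obtain ⟨_, x, hx, hq, hT, hvx⟩ := h.isTangentCoord_toFun hφ hv.1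
    have hA' := hv.2
    rw [hvx] at hA'
    have hW' : φ.E.toBase 1 ((tangentChart 𝒜 φ).toFun v).1 ∈ W := by
      rw [hq, hiff x hx]
      exact hA'
    exact ⟨hT, hW'⟩
  · rintro ⟨hp, hpW⟩
    have hpO : φ.E.toBase 1 p.1 ∈ φ.O := tangentRetract_subset hp
    rw [← hc.image_dom] at hpO
    obtain ⟨x, hx, hxp⟩ := hpO
    let t : TangentTuple 𝒜 := ⟨φ, hφ, x, hx, p.1, hxp.symm, p.2, hp⟩
    refine ⟨MTangent.mk t, ⟨hx, (hiff x hx).1 ?_⟩, h.tangentChart_mk t⟩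
    rw [hxp]
    exact hpW

/-- In charts `e` is the tangent map of the transition map. With `e = id` this gives compatibility
of the charts of `TX`, and otherwise the smoothness of the comparison maps. -/
theorem smooth_localRep_tangentChart (h𝒰 : IsAtlas 𝒰) (h : IsAtlas 𝒜) (h' : IsAtlas 𝒜')
    (h𝒜 : 𝒜 ⊆ 𝒰) (h𝒜' : 𝒜' ⊆ 𝒰) {e : MTangent 𝒜 → MTangent 𝒜'}
    (he : ∀ t t', e (MTangent.mk t) = MTangent.mk t' ↔ Related t t')
    (hφ : φ ∈ 𝒜) (hψ : ψ ∈ 𝒜') :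
    IsScSmoothOnRetract (tangentChart 𝒜 φ).C ((tangentChart 𝒜 φ).toFun ''
        ((tangentChart 𝒜 φ).dom ∩ e ⁻¹' (tangentChart 𝒜' ψ).dom))
      (localRep (tangentChart 𝒜 φ) (tangentChart 𝒜' ψ) e) := by
  have hproj := MTangent.proj_eq_of_related he
  have hdom : (tangentChart 𝒜 φ).dom ∩ e ⁻¹' (tangentChart 𝒜' ψ).dom =
      {v | (MTangent.proj v).1 ∈ φ.dom ∩ ψ.dom} := by
    ext v
    exact and_congr_right fun _ => iff_of_eq (congrArg (· ∈ ψ.dom) (hproj v))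
  have him : (tangentChart 𝒜 φ).toFun '' {v | (MTangent.proj v).1 ∈ φ.dom ∩ ψ.dom} =
      tangentRetract φ.C (overlap φ ψ) := h.image_tangentChart hφ (h'.1 ψ hψ).isOpen
  rw [hdom, him]
  refine (h𝒰.smooth_transition (h𝒜 hφ) (h𝒜' hψ)).tangent fun p hp => ?_
  rw [← him] at hp
  obtain ⟨v, hv, rfl⟩ := hp
  have hrep : localRep (tangentChart 𝒜 φ) (tangentChart 𝒜' ψ) e ((tangentChart 𝒜 φ).toFun v) =
      (tangentChart 𝒜' ψ).toFun (e v) := localRep_apply (h.injOn_tangentChart hφ) hv.1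
  rw [hrep]
  obtain ⟨_, x, hx, hq, hT, hvx⟩ := h.isTangentCoord_toFun hφ hv.1
  have hev : (MTangent.proj (e v)).1 ∈ ψ.dom := by
    rw [hproj]
    exact hv.2
  obtain ⟨_, x', hx', hq', hT', hvx'⟩ := h'.isTangentCoord_toFun hψ hev
  have hrel := (he _ _).1 ((congrArg e hvx.symm).trans hvx')
  have hxx : x = x' := hrel.1
  refine ⟨?_, hrel.2⟩
  rw [hq, hq', transition_apply (h.1 φ hφ).injOn hx, hxx]

theorem tangent_gluing (h : IsAtlas 𝒜) :
    TopologicalSpace.IsTopologicalBasis (chartPreimages (tangentAtlas 𝒜)) ∧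
      IsAtlas (tangentAtlas 𝒜) := by
  apply isTopologicalBasis_and_isAtlas_of_gluing rfl
  · rintro _ ⟨φ, hφ, rfl⟩
    exact (h.1 φ hφ).isScRetract.tangent
  · rintro _ ⟨φ, hφ, rfl⟩
    have := h.image_tangentChart hφ isOpen_univ
    rwa [inter_univ, (h.1 φ hφ).image_dom] at this
  · rintro _ ⟨φ, hφ, rfl⟩
    exact h.injOn_tangentChart hφ
  · rintro _ ⟨φ, hφ, rfl⟩ _ ⟨ψ, hψ, rfl⟩
    exact ⟨h.smooth_localRep_tangentChart (e := id) h h Subset.rfl Subset.rfl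
        (fun _ _ => h.mk_eq_mk) hφ hψ,
      h.smooth_localRep_tangentChart (e := id) h h Subset.rfl Subset.rfl
        (fun _ _ => h.mk_eq_mk) hψ hφ⟩
  · rintro _ ⟨φ, hφ, rfl⟩ _ ⟨ψ, hψ, rfl⟩
    obtain ⟨W, hW, hov⟩ := h.exists_overlap_eq hφ hψ
    refine ⟨tangentSet W, isOpen_tangentSet hW,
      (h.image_tangentChart hφ (h.1 ψ hψ).isOpen).trans ?_⟩
    exact (congrArg (tangentRetract φ.C) hov).trans
      (tangentRetract_inter_open (h.1 φ hφ).isScRetract hW)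
  · intro v
    obtain ⟨φ, hφ, hv⟩ := h.2.2 (MTangent.proj v).1
    exact ⟨_, ⟨φ, hφ, rfl⟩, hv⟩

/-- Represented in `Tφ` and the shifted `φ`, the projection is the sc-operator `E¹ ⊕ E → E¹`. -/
theorem isScSmoothMap_proj (h : IsAtlas 𝒜) :
    IsScSmoothMap (tangentAtlas 𝒜) (shiftedAtlas 𝒜) MTangent.proj := by
  refine isScSmoothMap_of_charts h.tangent_gluing.2 h.shifted_gluing.2 fun v => ?_
  obtain ⟨φ, hφ, hv⟩ := h.2.2 (MTangent.proj v).1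
  have hc := h.tangent_gluing.2.1 _ ⟨φ, hφ, rfl⟩
  have hdom : (tangentChart 𝒜 φ).dom ∩ MTangent.proj ⁻¹' (shiftedChart 𝒜 φ).dom =
      (tangentChart 𝒜 φ).dom := inter_self _
  refine ⟨_, ⟨φ, hφ, rfl⟩, _, ⟨φ, hφ, rfl⟩, hv, hv, ?_, ?_⟩
  · rw [hdom]
    exact hc.isOpen
  · rw [hdom, hc.image_dom]
    refine ((ScOperator.fst φ.E.shift φ.E).isScSmoothOnRetract hc.isScRetract).congr ?_
    rw [← hc.image_dom]
    rintro _ ⟨v, hv, rfl⟩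
    rw [localRep_apply hc.injOn hv]
    apply φ.E.toBase_injective 1
    obtain ⟨_, x, hx, hq, hT, hvx⟩ := h.isTangentCoord_toFun hφ hv
    refine Eq.trans ?_ (h.toBase_shiftedChart hφ (x := MTangent.proj v) hv).symm
    refine hq.trans ?_
    rw [hvx]
    rfl

theorem isMPolyfold_shiftedAtlas (h : IsAtlas 𝒜) [T2Space X] [ParacompactSpace X] :
    IsMPolyfold (shiftedAtlas 𝒜) := by
  have hg := h.shifted_gluing.2
  obtain ⟨h1, h2⟩ := t2Space_and_paracompactSpace_of_charts h.continuous_val_shifted fun x => by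
    obtain ⟨φ, hφ, hx⟩ := h.2.2 x
    exact ⟨φ.dom, (h.1 φ hφ).isOpen, hx, _, hg.1 _ ⟨φ, hφ, rfl⟩, Subset.rfl⟩
  exact ⟨h1, h2, hg⟩

theorem isMPolyfold_tangentAtlas (h : IsAtlas 𝒜) [T2Space X] [ParacompactSpace X] :
    IsMPolyfold (tangentAtlas 𝒜) := by
  have hg := h.tangent_gluing.2
  obtain ⟨h1, h2⟩ := t2Space_and_paracompactSpace_of_charts
    (h.continuous_val_shifted.comp h.isScSmoothMap_proj.1) fun x => by
      obtain ⟨φ, hφ, hx⟩ := h.2.2 x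
      exact ⟨φ.dom, (h.1 φ hφ).isOpen, hx, _, hg.1 _ ⟨φ, hφ, rfl⟩, Subset.rfl⟩
  exact ⟨h1, h2, hg⟩

/-! ### Independence of the atlas -/

theorem isScSmoothMap_shifted (h𝒰 : IsAtlas 𝒰) (h : IsAtlas 𝒜) (h' : IsAtlas 𝒜')
    (h𝒜 : 𝒜 ⊆ 𝒰) (h𝒜' : 𝒜' ⊆ 𝒰) {f : Shifted 𝒜 → Shifted 𝒜'} (hf : ∀ x, (f x).1 = x.1) :
    IsScSmoothMap (shiftedAtlas 𝒜) (shiftedAtlas 𝒜') f := by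
  refine isScSmoothMap_of_charts h.shifted_gluing.2 h'.shifted_gluing.2 fun x => ?_
  obtain ⟨φ, hφ, hx⟩ := h.2.2 x.1
  obtain ⟨ψ, hψ, hx'⟩ := h'.2.2 (f x).1
  refine ⟨_, ⟨φ, hφ, rfl⟩, _, ⟨ψ, hψ, rfl⟩, hx, hx', ?_,
    h𝒰.smooth_localRep_shiftedChart h h' h𝒜 h𝒜' hf hφ hψ⟩
  have hdom : f ⁻¹' (shiftedChart 𝒜' ψ).dom = (fun x : Shifted 𝒜 => x.1) ⁻¹' ψ.dom := by
    ext x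
    exact iff_of_eq (congrArg (· ∈ ψ.dom) (hf x))
  rw [hdom]
  exact ((h.shifted_gluing.2.1 _ ⟨φ, hφ, rfl⟩).isOpen).inter
    ((h'.1 ψ hψ).isOpen.preimage h.continuous_val_shifted)

theorem isScSmoothMap_tangent (h𝒰 : IsAtlas 𝒰) (h : IsAtlas 𝒜) (h' : IsAtlas 𝒜')
    (h𝒜 : 𝒜 ⊆ 𝒰) (h𝒜' : 𝒜' ⊆ 𝒰) {e : MTangent 𝒜 → MTangent 𝒜'}
    (he : ∀ t t', e (MTangent.mk t) = MTangent.mk t' ↔ Related t t') :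
    IsScSmoothMap (tangentAtlas 𝒜) (tangentAtlas 𝒜') e := by
  refine isScSmoothMap_of_charts h.tangent_gluing.2 h'.tangent_gluing.2 fun v => ?_
  obtain ⟨φ, hφ, hv⟩ := h.2.2 (MTangent.proj v).1
  obtain ⟨ψ, hψ, hv'⟩ := h'.2.2 (MTangent.proj (e v)).1
  refine ⟨_, ⟨φ, hφ, rfl⟩, _, ⟨ψ, hψ, rfl⟩, hv, hv', ?_,
    h𝒰.smooth_localRep_tangentChart h h' h𝒜 h𝒜' he hφ hψ⟩
  have hdom : e ⁻¹' (tangentChart 𝒜' ψ).dom =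
      ((fun x : Shifted 𝒜 => x.1) ∘ MTangent.proj) ⁻¹' ψ.dom := by
    ext v
    exact iff_of_eq (congrArg (· ∈ ψ.dom) (MTangent.proj_eq_of_related he v))
  rw [hdom]
  exact ((h.tangent_gluing.2.1 _ ⟨φ, hφ, rfl⟩).isOpen).inter
    ((h'.1 ψ hψ).isOpen.preimage (h.continuous_val_shifted.comp h.isScSmoothMap_proj.1))

/-- A related tuple is chosen for each representative; symmetry and transitivity across the two
atlases make its class independent of both choices. -/
theorem exists_tangent_map (h𝒰 : IsAtlas 𝒰) (h' : IsAtlas 𝒜')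
    (h𝒜 : 𝒜 ⊆ 𝒰) (h𝒜' : 𝒜' ⊆ 𝒰) : ∃ e : MTangent 𝒜 → MTangent 𝒜',
      ∀ t t', e (MTangent.mk t) = MTangent.mk t' ↔ Related t t' := by
  have hex : ∀ t : TangentTuple 𝒜, ∃ t' : TangentTuple 𝒜', Related t t' := fun t => by
    obtain ⟨ψ, hψ, hx⟩ := h'.2.2 t.pt
    obtain ⟨t', _, ht'⟩ := h𝒰.exists_related h𝒜 h𝒜' t hψ hx
    exact ⟨t', ht'⟩
  choose F hF using hex
  refine ⟨Quot.lift (fun t => MTangent.mk (F t)) fun t s hts => h'.mk_eq_mk.2 ?_, fun t t' => ?_⟩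
  · exact h𝒰.related_trans h𝒜' h𝒜 h𝒜' (h𝒰.related_symm h𝒜 h𝒜' (hF t))
      (h𝒰.related_trans h𝒜 h𝒜 h𝒜' hts (hF s))
  · refine h'.mk_eq_mk.trans ⟨fun ht => h𝒰.related_trans h𝒜 h𝒜' h𝒜' (hF t) ht, fun ht => ?_⟩
    exact h𝒰.related_trans h𝒜' h𝒜 h𝒜' (h𝒰.related_symm h𝒜 h𝒜' (hF t)) ht

theorem tangent_map_leftInverse (h𝒰 : IsAtlas 𝒰) (h𝒜 : 𝒜 ⊆ 𝒰) (h𝒜' : 𝒜' ⊆ 𝒰)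
    {e : MTangent 𝒜 → MTangent 𝒜'} {e' : MTangent 𝒜' → MTangent 𝒜}
    (he : ∀ t t', e (MTangent.mk t) = MTangent.mk t' ↔ Related t t')
    (he' : ∀ t t', e' (MTangent.mk t) = MTangent.mk t' ↔ Related t t') :
    Function.LeftInverse e' e := by
  intro v
  induction v using Quot.ind with | mk t => ?_
  obtain ⟨t', ht'⟩ := Quot.exists_rep (e (MTangent.mk t))
  have h1 : Related t t' := (he t t').1 ht'.symm
  have h2 : e (MTangent.mk t) = MTangent.mk t' := ht'.symm
  exact (congrArg e' h2).trans ((he' t' t).2 (h𝒰.related_symm h𝒜 h𝒜' h1))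

end IsAtlas

end Bundles

end ScCalculus

/-! ### Assembly of the theorem -/

theorem mainTheorem11 {X : Type v} [TopologicalSpace X] (𝒜 : Set (MChart.{u} X))
    (hX : IsMPolyfold 𝒜) :
    -- the relation on tuples is an equivalence relation
    Equivalence (Related : TangentTuple 𝒜 → TangentTuple 𝒜 → Prop) ∧
    -- the charts of `TX` are given by `Tφ [x, φ, ξ] = (φ(x), ξ)`
    (∀ t : TangentTuple 𝒜,
      (tangentChart 𝒜 t.chart).toFun (MTangent.mk t) = (t.base, t.vec)) ∧
    -- the preimages of open sets under the maps `Tφ` are a basis of the topology of `TX`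
    TopologicalSpace.IsTopologicalBasis (chartPreimages (tangentAtlas 𝒜)) ∧
    -- `TX` is Hausdorff and paracompact with M-polyfold atlas `T𝒜`; the same for `X¹`
    IsMPolyfold (tangentAtlas 𝒜) ∧
    IsMPolyfold (shiftedAtlas 𝒜) ∧
    -- `p : TX → X¹` is sc-smooth
    IsScSmoothMap (tangentAtlas 𝒜) (shiftedAtlas 𝒜) MTangent.proj ∧
    -- all this depends only on the equivalence class of the atlas `𝒜`
    (∀ 𝒜' : Set (MChart.{u} X), EquivAtlas 𝒜 𝒜' →
      ∃ (e : MTangent 𝒜 ≃ MTangent 𝒜') (e₁ : Shifted 𝒜 ≃ Shifted 𝒜'),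
        (∀ (t : TangentTuple 𝒜) (t' : TangentTuple 𝒜'),
          e (MTangent.mk t) = MTangent.mk t' ↔ Related t t') ∧
        (∀ x, (e₁ x).1 = x.1) ∧
        (∀ v, MTangent.proj (e v) = e₁ (MTangent.proj v)) ∧
        IsScDiffeo (tangentAtlas 𝒜) (tangentAtlas 𝒜') e ∧
        IsScDiffeo (shiftedAtlas 𝒜) (shiftedAtlas 𝒜') e₁) := by
  obtain ⟨_, _, h⟩ := hX
  refine ⟨h.equivalence_related, h.tangentChart_mk, h.tangent_gluing.1, h.isMPolyfold_tangentAtlas,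
    h.isMPolyfold_shiftedAtlas, h.isScSmoothMap_proj, fun 𝒜' ⟨_, h', h𝒰⟩ => ?_⟩
  have h₁ : 𝒜 ⊆ 𝒜 ∪ 𝒜' := subset_union_left
  have h₂ : 𝒜' ⊆ 𝒜 ∪ 𝒜' := subset_union_right
  obtain ⟨e, he⟩ := h𝒰.exists_tangent_map h' h₁ h₂
  obtain ⟨e', he'⟩ := h𝒰.exists_tangent_map h h₂ h₁
  have hl : levelSet 𝒜 1 ⊆ levelSet 𝒜' 1 := h𝒰.levelSet_subset h₁ h₂ h'.2.2 1
  have hl' : levelSet 𝒜' 1 ⊆ levelSet 𝒜 1 := h𝒰.levelSet_subset h₂ h₁ h.2.2 1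
  refine ⟨⟨e, e', h𝒰.tangent_map_leftInverse h₁ h₂ he he',
      h𝒰.tangent_map_leftInverse h₂ h₁ he' he⟩,
    ⟨fun x => ⟨x.1, hl x.2⟩, fun x => ⟨x.1, hl' x.2⟩, fun _ => rfl, fun _ => rfl⟩,
    he, fun _ => rfl, fun v => Subtype.ext (MTangent.proj_eq_of_related he v), ⟨?_, ?_⟩, ⟨?_, ?_⟩⟩
  · exact h𝒰.isScSmoothMap_tangent h h' h₁ h₂ he
  · exact h𝒰.isScSmoothMap_tangent h' h h₂ h₁ he'
  · exact h𝒰.isScSmoothMap_shifted h h' h₁ h₂ fun _ => rfl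
  · exact h𝒰.isScSmoothMap_shifted h' h h₂ h₁ fun _ => rfl
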